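/- **Conventions.** Let $(\Omega,\mathcal A,\mu)$ be a measure space and $X$ a real Banach space with dual $X'$; $\mathcal S(X)$ is the set of separable subsets of $X$. An *atom* is a set $A\in\mathcal A$ with $\mu(A)>0$ such that $\mu(B)\in\{0,\mu(A)\}$ for all measurable $B\subset A$. Let $\mathcal A_{a\sigma}$ be the system of the sets that are the union of countably many atoms and a measurable $\sigma$-finite set. A measurability property holds *integrally* if it holds on each $A\in\mathcal A_{a\sigma}$; a property holds *i.a.e.* (integrally almost everywhere) if it holds a.e. on each $A\in\mathcal A_{a\sigma}$. (If $\mu$ is $\sigma$-finite, i.a.e. means a.e., and "integrally" may be dropped.) For a family of extended real functions $\alpha_A$, $A\in\mathcal A_{a\sigma}$, each measurable on $A$ with respect to the completion and with $\alpha_A=\alpha_B$ a.e. on $A\cap B$, the *exhausting integral* is $\int\alpha^+-\int\alpha^-$ with $\int\alpha^\pm=\sup_{A\in\mathcal A_{a\sigma}}\int_A\alpha_A^\pm\,d\bar\mu$ and $\infty-\infty:=\infty$; a single function is the family of its restrictions. All integrals below are exhausting integrals; for $\sigma$-finite $\mu$ they are extended Lebesgue integrals. A set $R$ of functions $\Omega\to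 X$ is *almost decomposable* if for all $u_0\in R$, $F\in\mathcal A$ with $\mu(F)<\infty$, $\varepsilon>0$ and bounded strongly measurable $u_1:F\to X$ there is a measurable $F_\varepsilon\subset F$ with $\mu(F\setminus F_\varepsilon)<\varepsilon$ such that the function equal to $u_1$ on $F_\varepsilon$ and to $u_0$ on $\Omega\setminus F_\varepsilon$ belongs to $R$. For $g:X\to[-\infty,\infty]$ and $W\subset X$, $\partial g_W(x)$ is the set of $x'\in X'$ such that $x\in W$, $g(x)\in\mathbb R$ and $g(y)\ge g(x)+\langle x',y-x\rangle$ for all $y\in W$; put $\partial g=\partial g_X$ and $g^*(x')=\sup_{x\in X}\langle x',x\rangle-g(x)$. **Theorem.** Let $R$ be an almost decomposable linear space of integrally strongly measurable functions $\Omega\to X$, and $S$ a linear space of integrally weak* measurable functions $\Omega\to X'$ such that $\langle u,v\rangle=\int\langle v(\omega),u(\omega)\rangle\,d\mu(\omega)$ is finite for all $u\in R$, $v\in S$. Let $f:\Omega\times X\to[-\infty,\infty]$ be integrally separably measurable, i.e. $f|_{A\times W}$ is $\mathcal A(A)\otimes\mathcal B(W)$-measurable for all $A\in\mathcal A_{a\sigma}$,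 $W\in\mathcal S(X)$, where $\mathcal A(A)$ is the trace of $\mathcal A$ on $A$. Let $I_f(u)=\int f(\omega,u(\omega))\,d\mu(\omega)$ and suppose $I_f\not\equiv\infty$ on $R$. Put $$I_f^*(v)=\sup_{u\in R}\langle u,v\rangle-I_f(u),\qquad \partial I_f(u)=\{v\in S: I_f(w)\ge I_f(u)+\langle w-u,v\rangle\ \ \forall w\in R\}\quad\text{for } u\in R,\ I_f(u)\in\mathbb R .$$ Let $v\in S$ be such that for every atom $A$ with $\mu(A)=\infty$ and every $W\in\mathcal S(X)$ one has $\sup_{x\in W}\langle v(\omega),x\rangle-f_\omega(x)\le0$ for a.e. $\omega\in A$. Then: 1. On each $A\in\mathcal A_{a\sigma}$ the essential supremum function of the family $\omega\mapsto\sup_{x\in W}\langle v(\omega),x\rangle-f_\omega(x)$, $W\in\mathcal S(X)$, exists, and $$I_f^*(v)=\int\operatorname*{ess\,sup}_{W\in\mathcal S(X)}\ \sup_{x\in W}\langle v(\omega),x\rangle-f_\omega(x)\,d\bar\mu(\omega).$$ 2. Let $u\in R$ with $I_f(u)\in\mathbb R$. Then $v\in\partial I_f(u)$ if and only if for every $A\in\mathcal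 A_{a\sigma}$ and every $W\in\mathcal S(X)$ with $u(\omega)\in W$ for a.e. $\omega\in A$ one has $v(\omega)\in\partial (f_\omega)_W(u(\omega))$ for a.e. $\omega\in A$. If the set $\mathcal S_u(X)$ of those $W\in\mathcal S(X)$ with $u(\omega)\in W$ i.a.e. is non-empty, this is equivalent to $$v\in\bigcap_{W\in\mathcal S_u(X)}\{v'\in S: v'(\omega)\in\partial (f_\omega)_W(u(\omega))\ \text{i.a.e.}\}.$$ 3. Let $I_f^*(v)<\infty$. The following are equivalent: (i) $\omega\mapsto f^*_\omega(v(\omega))$ is integrally measurable with respect to the completion $\mathcal A_\mu$, and $I_f^*(v)=\int f_\omega^*(v(\omega))\,d\bar\mu(\omega)$; (ii) for every $A\in\mathcal A_{a\sigma}$ there is $W\in\mathcal S(X)$ with $f^*_\omega(v(\omega))=\sup_{x\in W}\langle v(\omega),x\rangle-f_\omega(x)$ for a.e. $\omega\in A$. If $\mathcal S_u(X)\neq\emptyset$ for every $u\in R$ (for instance if the elements of $R$ are strongly measurable, or if $\mu$ is $\sigma$-finite), then (i) is also equivalent to the existence of a single $W\in\mathcal S(X)$ with $f^*_\omega(v(\omega))=\sup_{x\in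 W}\langle v(\omega),x\rangle-f_\omega(x)$ i.a.e. If (ii) holds, then for every $u\in R$ with $I_f(u)\in\mathbb R$: $v\in\partial I_f(u)$ if and only if $v(\omega)\in\partial f_\omega(u(\omega))$ i.a.e. -/

import Mathlib

open MeasureTheory TopologicalSpace
open scoped ENNReal

noncomputable section

namespace IntegralConjugate

variable {Ω X : Type*} [MeasurableSpace Ω]

/-! ### Atoms, the σ-ring `𝒜_{aσ}`, integrally almost everywhere -/

/-- An atom of `μ`: a measurable set of positive (possibly infinite) measure, each measurable
subset of which has measure `0` or full measure. -/
def IsMeasureAtom (μ : Measure Ω) (A : Set Ω) : Prop :=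
  MeasurableSet A ∧ 0 < μ A ∧
    ∀ B : Set Ω, MeasurableSet B → B ⊆ A → μ B = 0 ∨ μ B = μ A

/-- The σ-ring of the sets that are the union of countably many atoms and a σ-finite set. -/
def atomSigma (μ : Measure Ω) : Set (Set Ω) :=
  {A | ∃ (C : Set (Set Ω)) (B : Set Ω), C.Countable ∧ (∀ D ∈ C, IsMeasureAtom μ D) ∧
    MeasurableSet B ∧ SigmaFinite (μ.restrict B) ∧ A = ⋃₀ C ∪ B}

/-- `p` holds integrally almost everywhere: the exceptional set meets every set of `atomSigma μ`
in a null set. -/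
def IAE (μ : Measure Ω) (p : Ω → Prop) : Prop :=
  ∀ A ∈ atomSigma μ, ∀ᵐ ω ∂(μ.restrict A), p ω

/-! ### The exhausting integral -/

/-- The exhausting integral of the positive parts of a family `α A`, `A ∈ atomSigma μ`. -/
def exhLIntegralFam (μ : Measure Ω) (α : Set Ω → Ω → EReal) : ℝ≥0∞ :=
  ⨆ A ∈ atomSigma μ, ∫⁻ ω in A, (α A ω).toENNReal ∂μ

open Classical in
/-- The exhausting integral of a family `α A`, `A ∈ atomSigma μ`: the integral of the positive part
minus the integral of the negative part, with the convention `∞ - ∞ = ∞`.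
The families to which this is applied are a.e. measurable on `A`, and there `∫⁻ … ∂μ` is the same
as the integral with respect to the completion of `μ`. -/
def exhIntegralFam (μ : Measure Ω) (α : Set Ω → Ω → EReal) : EReal :=
  if exhLIntegralFam μ α = ∞ then ⊤
  else (exhLIntegralFam μ α : EReal) - (exhLIntegralFam μ (fun A ω => -α A ω) : EReal)

/-- The exhausting integral of a single function. -/
def exhIntegral (μ : Measure Ω) (α : Ω → EReal) : EReal :=
  exhIntegralFam μ (fun _ => α)

/-! ### Essential suprema of arbitrary families -/

/-- `m` is an essential supremum function on `A` of the family `φ i`: an a.e. measurable a.e. upper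
bound of each `φ i` on `A` that lies a.e. below every other one. -/
def IsEssSupOn {ι : Type*} (μ : Measure Ω) (A : Set Ω) (φ : ι → Ω → EReal) (m : Ω → EReal) :
    Prop :=
  AEMeasurable m (μ.restrict A) ∧ (∀ i, ∀ᵐ ω ∂(μ.restrict A), φ i ω ≤ m ω) ∧
    ∀ n : Ω → EReal, AEMeasurable n (μ.restrict A) →
      (∀ i, ∀ᵐ ω ∂(μ.restrict A), φ i ω ≤ n ω) → ∀ᵐ ω ∂(μ.restrict A), m ω ≤ n ω

/-! ### Integral measurability -/

variable [NormedAddCommGroup X] [NormedSpace ℝ X]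

/-- `u` is strongly measurable on every set of `atomSigma μ`. -/
def IntegrallyStronglyMeasurable (μ : Measure Ω) (u : Ω → X) : Prop :=
  ∀ A ∈ atomSigma μ, StronglyMeasurable (fun ω : A => u ω)

/-- `v` is weak* measurable on every set of `atomSigma μ`. -/
def IntegrallyWeakStarMeasurable (μ : Measure Ω) (v : Ω → X →L[ℝ] ℝ) : Prop :=
  ∀ A ∈ atomSigma μ, ∀ x : X, Measurable (fun ω : A => v ω x)

/-- For all `A ∈ atomSigma μ` and all separable `W`, the restriction of the integrand `f` to
`A × W` is measurable for the product of the trace σ-algebra on `A` and the Borel σ-algebra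
of `W`. -/
def IntegrallySeparablyMeasurable [MeasurableSpace X] (μ : Measure Ω) (f : Ω → X → EReal) :
    Prop :=
  ∀ A ∈ atomSigma μ, ∀ W : Set X, IsSeparable W →
    Measurable (fun p : A × W => f (p.1 : Ω) (p.2 : X))

open Classical in
/-- Almost decomposability of a space of functions. A bounded strongly measurable function on the
measurable set `F` is given through its extension by `0`. -/
def AlmostDecomposable (μ : Measure Ω) (R : Set (Ω → X)) : Prop :=
  ∀ u₀ ∈ R, ∀ F : Set Ω, MeasurableSet F → μ F < ∞ → ∀ ε : ℝ≥0∞, 0 < ε →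
    ∀ u₁ : Ω → X, StronglyMeasurable u₁ → (∃ C : ℝ, ∀ ω, ‖u₁ ω‖ ≤ C) →
      ∃ Fε : Set Ω, Fε ⊆ F ∧ MeasurableSet Fε ∧ μ (F \ Fε) < ε ∧ Fε.piecewise u₁ u₀ ∈ R

/-! ### Integral functionals, conjugates, subdifferentials -/

/-- `I_f(u) = ∫ f(ω, u(ω)) dμ(ω)`. -/
def integralFunctional (μ : Measure Ω) (f : Ω → X → EReal) (u : Ω → X) : EReal :=
  exhIntegral μ (fun ω => f ω (u ω))

/-- The pairing `∫ ⟨v(ω), u(ω)⟩ dμ(ω)`. -/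
def pairing (μ : Measure Ω) (u : Ω → X) (v : Ω → X →L[ℝ] ℝ) : EReal :=
  exhIntegral μ (fun ω => ((v ω (u ω) : ℝ) : EReal))

/-- The convex conjugate at `v` of `I_f : R → [-∞, ∞]` with respect to the pairing. -/
def conjugateFunctional (μ : Measure Ω) (f : Ω → X → EReal) (R : Submodule ℝ (Ω → X))
    (v : Ω → X →L[ℝ] ℝ) : EReal :=
  ⨆ u ∈ R, pairing μ u v - integralFunctional μ f u

/-- `sup_{x ∈ W} ⟨x', x⟩ - g(x)`. -/
def conjugateOn (g : X → EReal) (W : Set X) (x' : X →L[ℝ] ℝ) : EReal :=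
  ⨆ x ∈ W, ((x' x : ℝ) : EReal) - g x

/-- The convex conjugate `g*(x') = sup_{x ∈ X} ⟨x', x⟩ - g(x)`. -/
def conjugate (g : X → EReal) (x' : X →L[ℝ] ℝ) : EReal :=
  ⨆ x : X, ((x' x : ℝ) : EReal) - g x

/-- The subdifferential at `x` of the restriction of `g` to `W`, as the set of those `x'` whose
restriction to `W` is a subgradient. It is empty where `g` is not finite. -/
def subdifferentialOn (g : X → EReal) (W : Set X) (x : X) : Set (X →L[ℝ] ℝ) :=
  {x' | x ∈ W ∧ g x ≠ ⊤ ∧ g x ≠ ⊥ ∧ ∀ y ∈ W, g x + ((x' (y - x) : ℝ) : EReal) ≤ g y}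

/-- The Fenchel-Moreau subdifferential at `u ∈ R` of `I_f : R → [-∞, ∞]` with respect to the pairing
of `R` and `S`. It is empty where `I_f` is not finite. -/
def subdifferentialFunctional (μ : Measure Ω) (f : Ω → X → EReal) (R : Submodule ℝ (Ω → X))
    (S : Submodule ℝ (Ω → X →L[ℝ] ℝ)) (u : Ω → X) : Set (Ω → X →L[ℝ] ℝ) :=
  {v | v ∈ S ∧ integralFunctional μ f u ≠ ⊤ ∧ integralFunctional μ f u ≠ ⊥ ∧
    ∀ w ∈ R, integralFunctional μ f u + pairing μ (w - u) v ≤ integralFunctional μ f w}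

/-- The separable sets that almost contain the range of `u`. -/
def separableRange (μ : Measure Ω) (u : Ω → X) : Set (Set X) :=
  {W | IsSeparable W ∧ IAE μ (fun ω => u ω ∈ W)}

end IntegralConjugate

end

/-!
Since `atomSigma μ` is closed under countable unions, all the exhausting integrals are extended
Lebesgue integrals over one and the same `A`. On `A` a single closed separable set `W` realizes the
essential supremum: it maximizes the integral of a bounded strictly increasing function of
`sup_{x ∈ W} ⟨v, x⟩ - f(x)`. This supremum dominates `⟨v, u⟩ - f(u)` for `u ∈ R`, whence
`I_f*(v) ≤ ∫ ess sup`. Conversely, fix `u₀ ∈ R` with `I_f(u₀)` finite. On the atoms of infinite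
measure `⟨v, u₀⟩ - f(u₀)` is nonnegative, because the integrals are finite, so the supremum is `0`
and attained there. On the σ-finite rest Aumann's selection theorem yields almost maximizers with
values in `W`, which almost decomposability glues to `u₀` off a set of small measure.

`v ∈ ∂I_f(u)` is equality in the Fenchel–Young inequality, and two functions `φ ≤ ψ` with the same
finite integral agree a.e.; this turns the formula for `I_f*(v)` into pointwise statements.
-/

noncomputable section

namespace IntegralConjugate

/-! ### Measurable selections -/

section MeasurableSelection

variable {Ω Y Z : Type*} [MeasurableSpace Ω] [MeasurableSpace Y]

/-- The points of the Baire space whose first `n` coordinates are bounded by those of `b`. -/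
def boundedPrefix (n : ℕ) (b : ℕ → ℕ) : Set (ℕ → ℕ) := {x | ∀ i < n, x i ≤ b i}

lemma boundedPrefix_zero (b : ℕ → ℕ) : boundedPrefix 0 b = Set.univ := by
  simp [boundedPrefix]

lemma boundedPrefix_congr {n : ℕ} {b c : ℕ → ℕ} (h : ∀ i < n, b i = c i) :
    boundedPrefix n b = boundedPrefix n c :=
  Set.ext fun _ => forall₂_congr fun i hi => by rw [h i hi]

lemma mem_boundedPrefix_succ_update {n m : ℕ} {b x : ℕ → ℕ} :
    x ∈ boundedPrefix (n + 1) (Function.update b n m) ↔ x ∈ boundedPrefix n b ∧ x n ≤ m := by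
  simp only [boundedPrefix, Set.mem_ofPred_eq, Nat.forall_lt_succ_right, Function.update_self]
  refine and_congr_left' (forall₂_congr fun i hi => ?_)
  rw [Function.update_of_ne hi.ne]

lemma iUnion_boundedPrefix_succ_update (n : ℕ) (b : ℕ → ℕ) :
    ⋃ m, boundedPrefix (n + 1) (Function.update b n m) = boundedPrefix n b := by
  ext x
  simp only [Set.mem_iUnion, mem_boundedPrefix_succ_update, exists_and_left]
  exact and_iff_left ⟨x n, le_rfl⟩

lemma monotone_boundedPrefix_succ_update (n : ℕ) (b : ℕ → ℕ) :
    Monotone fun m => boundedPrefix (n + 1) (Function.update b n m) := fun _ _ hm _ hx =>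
  mem_boundedPrefix_succ_update.2
    ((mem_boundedPrefix_succ_update.1 hx).imp_right fun h => h.trans hm)

lemma isCompact_setOf_forall_le (b : ℕ → ℕ) : IsCompact {x : ℕ → ℕ | ∀ i, x i ≤ b i} :=
  isCompact_pi_infinite fun i => (Set.finite_Iic (b i)).isCompact

lemma exists_boundedPrefix_subset {b : ℕ → ℕ} {V : Set (ℕ → ℕ)} (hV : IsOpen V)
    (hb : {x : ℕ → ℕ | ∀ i, x i ≤ b i} ⊆ V) : ∃ n, boundedPrefix n b ⊆ V := by
  by_contra! hcon
  choose x hxb hxV using fun n => Set.not_subset.1 (hcon n)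
  obtain ⟨a, ha, φ, hφ, hlim⟩ := (isCompact_setOf_forall_le b).tendsto_subseq
    (x := fun n i => min (x n i) (b i)) fun n i => min_le_right _ _
  have hlim' : Filter.Tendsto (x ∘ φ) Filter.atTop (nhds a) := by
    rw [tendsto_pi_nhds] at hlim ⊢
    intro i
    refine (hlim i).congr' ?_
    filter_upwards [Filter.eventually_gt_atTop i] with n hn
    exact min_eq_left (hxb (φ n) i (hn.trans_le hφ.le_apply))
  obtain ⟨n, hn⟩ := (hlim'.eventually (hV.mem_nhds (hb ha))).exists
  exact hxV _ hn

/-- Dependent choice of the successive values of a sequence. -/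
lemma exists_forall_of_forall_exists_update {α : Type*} {P : ℕ → (ℕ → α) → Prop}
    (hcongr : ∀ n b c, (∀ i < n, b i = c i) → P n b → P n c) (hzero : ∃ b, P 0 b)
    (hsucc : ∀ n b, P n b → ∃ a, P (n + 1) (Function.update b n a)) : ∃ b, ∀ n, P n b := by
  obtain ⟨b₀, hb₀⟩ := hzero
  choose a ha using hsucc
  let B : ∀ n, {b // P n b} := fun n =>
    Nat.rec ⟨b₀, hb₀⟩ (fun n b => ⟨Function.update b n (a n b b.2), ha n b b.2⟩) n
  have hB : ∀ i n, i + 1 ≤ n → (B n).1 i = (B (i + 1)).1 i := by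
    intro i n hn
    induction n, hn using Nat.le_induction with
    | base => rfl
    | succ n hn ih => exact (Function.update_of_ne (Nat.lt_of_succ_le hn).ne _ _).trans ih
  exact ⟨fun i => (B (i + 1)).1 i, fun n => hcongr n _ _ (hB · n) (B n).2⟩

lemma exists_forall_lt_measure_image_boundedPrefix (ν : Measure Y) (h : (ℕ → ℕ) → Y) {c : ℝ≥0∞}
    (hc : c < ν (Set.range h)) : ∃ b : ℕ → ℕ, ∀ n, c < ν (h '' boundedPrefix n b) := by
  refine exists_forall_of_forall_exists_update
    (fun n b b' hb hlt => boundedPrefix_congr hb ▸ hlt) ⟨0, ?_⟩ fun n b hlt => ?_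
  · rwa [boundedPrefix_zero, Set.image_univ]
  · have hmono : Monotone fun m => h '' boundedPrefix (n + 1) (Function.update b n m) :=
      fun _ _ hm => Set.image_mono (monotone_boundedPrefix_succ_update n b hm)
    rw [← iUnion_boundedPrefix_succ_update n b, Set.image_iUnion, hmono.measure_iUnion] at hlt
    exact lt_iSup_iff.1 hlt

lemma exists_isCompact_le_measure_image [TopologicalSpace Y] (ν : Measure Y) [ν.OuterRegular]
    {h : (ℕ → ℕ) → Y} (hh : Continuous h) {c : ℝ≥0∞} (hc : c < ν (Set.range h)) :
    ∃ K, IsCompact K ∧ c ≤ ν (h '' K) := by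
  obtain ⟨b, hb⟩ := exists_forall_lt_measure_image_boundedPrefix ν h hc
  refine ⟨_, isCompact_setOf_forall_le b, ?_⟩
  rw [Set.measure_eq_iInf_isOpen]
  refine le_iInf₂ fun U hU => le_iInf fun hUo => ?_
  obtain ⟨n, hn⟩ := exists_boundedPrefix_subset (hUo.preimage hh) (Set.image_subset_iff.1 hU)
  exact (hb n).le.trans (measure_mono (Set.image_subset_iff.2 hn))

lemma exists_isCompact_measure_range_diff_iUnion_eq_zero [TopologicalSpace Y] [T2Space Y]
    [OpensMeasurableSpace Y] (ν : Measure Y) [IsFiniteMeasure ν] [ν.OuterRegular]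
    {h : (ℕ → ℕ) → Y} (hh : Continuous h) :
    ∃ K : ℕ → Set (ℕ → ℕ), (∀ n, IsCompact (K n)) ∧ ν (Set.range h \ ⋃ n, h '' K n) = 0 := by
  by_cases hzero : ν (Set.range h) = 0
  · exact ⟨fun _ => ∅, fun _ => isCompact_empty, measure_mono_null Set.sdiff_subset hzero⟩
  have happrox : ∀ n : ℕ, ∃ K, IsCompact K ∧ ν (Set.range h) - (n : ℝ≥0∞)⁻¹ ≤ ν (h '' K) :=
    fun n => exists_isCompact_le_measure_image ν hh
      (ENNReal.sub_lt_self (measure_ne_top _ _) hzero (by simp))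
  choose K hK hKν using happrox
  refine ⟨K, hK, le_antisymm (ge_of_tendsto' ENNReal.tendsto_inv_nat_nhds_zero fun n => ?_)
    bot_le⟩
  calc ν (Set.range h \ ⋃ n, h '' K n) ≤ ν (Set.range h \ h '' K n) :=
        measure_mono (Set.sdiff_subset_sdiff_right (Set.subset_iUnion (fun n => h '' K n) n))
    _ = ν (Set.range h) - ν (h '' K n) :=
        measure_sdiff (Set.image_subset_range _ _)
          ((hK n).image hh).measurableSet.nullMeasurableSet (measure_ne_top _ _)
    _ ≤ (n : ℝ≥0∞)⁻¹ := tsub_le_iff_tsub_le.1 (hKν n)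

lemma exists_continuous_injective_baire_real :
    ∃ e : (ℕ → ℕ) → ℝ, Continuous e ∧ Function.Injective e := by
  let d : (ℕ → ℕ) → (ℕ → Bool) := fun x k => decide (x k.unpair.1 = k.unpair.2)
  have hd : Continuous d := continuous_pi fun k =>
    (continuous_of_discreteTopology (f := fun n : ℕ => decide (n = k.unpair.2))).comp
      (continuous_apply k.unpair.1)
  have hdi : Function.Injective d := fun x y hxy => funext fun i => by
    simpa [d, eq_comm] using congrFun hxy (Nat.pair i (x i))
  exact ⟨fun x => (cantorSetHomeomorphNatToBool.symm (d x) : ℝ),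
    continuous_subtype_val.comp (cantorSetHomeomorphNatToBool.symm.continuous.comp hd),
    Subtype.val_injective.comp (cantorSetHomeomorphNatToBool.symm.injective.comp hdi)⟩

section LeastPointOfFiber

variable {A B : Type*} [TopologicalSpace A] [TopologicalSpace B] [T2Space B]
  {h : A → B} {e : A → ℝ} {K : Set A}

lemma isLeast_sInf_image_inter_fiber (hh : Continuous h) (he : Continuous e) (hK : IsCompact K)
    {y : B} (hy : y ∈ h '' K) :
    IsLeast (e '' (K ∩ h ⁻¹' {y})) (sInf (e '' (K ∩ h ⁻¹' {y}))) := by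
  obtain ⟨x, hx, rfl⟩ := hy
  exact ((hK.inter_right (isClosed_singleton.preimage hh)).image he).isLeast_sInf
    ⟨e x, x, ⟨hx, rfl⟩, rfl⟩

lemma measurable_sInf_image_inter_fiber [MeasurableSpace B] [OpensMeasurableSpace B]
    (hh : Continuous h) (he : Continuous e) (hK : IsCompact K) :
    Measurable fun y => sInf (e '' (K ∩ h ⁻¹' {y})) := by
  have hKm : MeasurableSet (h '' K) := (hK.image hh).measurableSet
  refine measurable_of_restrict_of_restrict_compl hKm ?_ ?_
  · refine measurable_of_Iic fun c => ⟨h '' (K ∩ e ⁻¹' Set.Iic c), ?_, ?_⟩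
    · exact ((hK.inter_right (isClosed_Iic.preimage he)).image hh).measurableSet
    ext ⟨y, hy⟩
    have hleast := isLeast_sInf_image_inter_fiber hh he hK hy
    constructor
    · rintro ⟨x, ⟨hx, hxc⟩, hxy⟩
      exact (hleast.2 ⟨x, ⟨hx, hxy⟩, rfl⟩).trans hxc
    · intro hc
      obtain ⟨x, ⟨hx, hxy⟩, hex⟩ := hleast.1
      exact ⟨x, ⟨hx, hex.trans_le hc⟩, hxy⟩
  · have hconst : (h '' K)ᶜ.domRestrict (fun y => sInf (e '' (K ∩ h ⁻¹' {y}))) =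
        fun _ => 0 := by
      ext ⟨y, hy⟩
      have hempty : K ∩ h ⁻¹' {y} = ∅ :=
        Set.eq_empty_of_forall_notMem fun x hx => hy ⟨x, hx.1, hx.2⟩
      rw [Set.domRestrict_apply, hempty, Set.image_empty, Real.sInf_empty]
    exact hconst ▸ measurable_const

end LeastPointOfFiber

/-- The section picks the point of the fiber that comes first for a continuous injection of the
Baire space into `ℝ`. -/
lemma exists_measurable_section_of_isCompact [TopologicalSpace Y] [T2Space Y]
    [OpensMeasurableSpace Y] {h : (ℕ → ℕ) → Y} (hh : Continuous h) {K : Set (ℕ → ℕ)}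
    (hK : IsCompact K) : ∃ σ : Y → ℕ → ℕ, Measurable σ ∧ ∀ y ∈ h '' K, h (σ y) = y := by
  obtain ⟨e, he, hei⟩ := exists_continuous_injective_baire_real
  obtain ⟨g, hg, hge⟩ := (he.measurableEmbedding hei).exists_measurable_extend measurable_id
    fun _ => inferInstance
  refine ⟨_, hg.comp (measurable_sInf_image_inter_fiber hh he hK), fun y hy => ?_⟩
  obtain ⟨x, ⟨_, hxy⟩, hex⟩ := (isLeast_sInf_image_inter_fiber hh he hK hy).1
  rw [Function.comp_apply, ← hex, show g (e x) = x from congrFun hge x]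
  exact hxy

lemma exists_measurable_forall_mem_iUnion [MeasurableSpace Z] [Nonempty Z] {T : ℕ → Set Y}
    (hT : ∀ n, MeasurableSet (T n)) {s : ℕ → Y → Z} (hs : ∀ n, Measurable (s n)) :
    ∃ σ : Y → Z, Measurable σ ∧ ∀ y ∈ ⋃ n, T n, ∃ n, y ∈ T n ∧ σ y = s n y := by
  obtain ⟨σ, hσ, hσs⟩ := exists_measurable_piecewise (disjointed T)
    (MeasurableSet.disjointed hT) s hs
    fun _ _ hij _ hy => ((disjoint_disjointed T hij).le_bot hy).elim
  refine ⟨σ, hσ, fun y hy => ?_⟩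
  obtain ⟨n, hn⟩ := Set.mem_iUnion.1 (iUnion_disjointed.superset hy)
  exact ⟨n, disjointed_subset T n hn, hσs n hn⟩

lemma exists_measurable_section_ae [TopologicalSpace Y] [T2Space Y] [OpensMeasurableSpace Y]
    (ν : Measure Y) [IsFiniteMeasure ν] [ν.OuterRegular] {h : (ℕ → ℕ) → Y} (hh : Continuous h) :
    ∃ σ : Y → ℕ → ℕ, Measurable σ ∧ ∀ᵐ y ∂ν, y ∈ Set.range h → h (σ y) = y := by
  obtain ⟨K, hK, hnull⟩ := exists_isCompact_measure_range_diff_iUnion_eq_zero ν hh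
  choose s hs hsK using fun n => exists_measurable_section_of_isCompact hh (hK n)
  obtain ⟨σ, hσ, hσs⟩ := exists_measurable_forall_mem_iUnion
    (fun n => ((hK n).image hh).measurableSet) hs
  refine ⟨σ, hσ, ?_⟩
  filter_upwards [measure_eq_zero_iff_ae_notMem.1 hnull] with y hy hyr
  obtain ⟨n, hyn, hσn⟩ := hσs y (by_contra fun hyK => hy ⟨hyr, hyK⟩)
  exact hσn ▸ hsK n y hyn

/-- A measurable set of a product depends on its first variable through a map into the Cantor
space. -/
lemma exists_preimage_prodMap_eq [MeasurableSpace Z] {G : Set (Ω × Z)} (hG : MeasurableSet G) :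
    ∃ (φ : Ω → ℕ → Bool) (G' : Set ((ℕ → Bool) × Z)), Measurable φ ∧ MeasurableSet G' ∧
      G = Prod.map φ id ⁻¹' G' := by
  classical
  rw [← generateFrom_prod] at hG
  induction G, hG using MeasurableSpace.generateFrom_induction with
  | hC G hG _ =>
    obtain ⟨s, hs, t, ht, rfl⟩ := hG
    refine ⟨fun ω _ => decide (ω ∈ s), {y | y 0 = true} ×ˢ t, ?_, ?_, ?_⟩
    · exact measurable_pi_lambda _ fun _ => measurable_to_bool (by
        simpa [Set.preimage] using hs)
    · exact (measurableSet_eq_fun (measurable_pi_apply 0) measurable_const).prod ht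
    · ext ⟨ω, z⟩; simp
  | empty => exact ⟨fun _ _ => true, ∅, measurable_const, MeasurableSet.empty, rfl⟩
  | compl G _ ih =>
    obtain ⟨φ, G', hφ, hG', rfl⟩ := ih
    exact ⟨φ, G'ᶜ, hφ, hG'.compl, rfl⟩
  | iUnion G _ ih =>
    choose φ G' hφ hG' hGG using ih
    refine ⟨fun ω k => φ k.unpair.1 ω k.unpair.2,
      ⋃ n, Prod.map (fun y k => y (Nat.pair n k)) id ⁻¹' G' n, ?_, ?_, ?_⟩
    · exact measurable_pi_lambda _ fun k => (measurable_pi_apply _).comp (hφ _)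
    · refine MeasurableSet.iUnion fun n => ?_
      exact ((measurable_pi_lambda _ fun k => measurable_pi_apply _).prodMap measurable_id) (hG' n)
    · rw [Set.preimage_iUnion]
      refine Set.iUnion_congr fun n => ?_
      rw [hGG n]
      ext ⟨ω, z⟩
      simp

variable [TopologicalSpace Z] [PolishSpace Z] [MeasurableSpace Z] [BorelSpace Z]

/-- Aumann's selection theorem. -/
theorem exists_measurable_selection (ν : Measure Ω) [SFinite ν] [Nonempty Z] {G : Set (Ω × Z)}
    (hG : MeasurableSet G) :
    ∃ s : Ω → Z, Measurable s ∧ ∀ᵐ ω ∂ν, (∃ z, (ω, z) ∈ G) → (ω, s ω) ∈ G := by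
  obtain ⟨φ, G', hφ, hG', rfl⟩ := exists_preimage_prodMap_eq hG
  have : PolishSpace Bool := inferInstance
  have hanalytic := hG'.analyticSet
  rw [AnalyticSet] at hanalytic
  rcases hanalytic with rfl | ⟨g, hg, rfl⟩
  · exact ⟨fun _ => Classical.arbitrary Z, measurable_const, by simp⟩
  obtain ⟨σ, hσ, hσg⟩ := exists_measurable_section_ae (ν.toFinite.map φ) (continuous_fst.comp hg)
  refine ⟨fun ω => (g (σ (φ ω))).2, hg.snd.measurable.comp (hσ.comp hφ), ?_⟩
  rw [← ae_toFinite]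
  filter_upwards [ae_of_ae_map hφ.aemeasurable hσg] with ω hω
  rintro ⟨z, x, hx⟩
  have hfst : (g (σ (φ ω))).1 = φ ω := hω ⟨x, by simp [hx]⟩
  exact ⟨σ (φ ω), Prod.ext hfst rfl⟩

/-- The measurable projection theorem. -/
theorem nullMeasurableSet_projection (ν : Measure Ω) [SFinite ν] {G : Set (Ω × Z)}
    (hG : MeasurableSet G) : NullMeasurableSet {ω | ∃ z, (ω, z) ∈ G} ν := by
  rcases isEmpty_or_nonempty Z with _ | _
  · simp
  obtain ⟨s, hs, hsG⟩ := exists_measurable_selection ν hG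
  refine ((measurable_id.prodMk hs) hG).nullMeasurableSet.congr ?_
  rw [Filter.eventuallyEq_set]
  filter_upwards [hsG] with ω hω
  exact ⟨fun h => ⟨s ω, h⟩, hω⟩

theorem aemeasurable_iSup_of_polishSpace {β : Type*} [CompleteLinearOrder β] [TopologicalSpace β]
    [OrderTopology β] [SecondCountableTopology β] [MeasurableSpace β] [BorelSpace β]
    (ν : Measure Ω) [SFinite ν] {F : Ω × Z → β} (hF : Measurable F) :
    AEMeasurable (fun ω => ⨆ z, F (ω, z)) ν := by
  have hnull : NullMeasurable (fun ω => ⨆ z, F (ω, z)) ν := by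
    refine measurable_of_Ioi (δ := NullMeasurableSpace Ω ν) fun c => ?_
    have hset : (fun ω => ⨆ z, F (ω, z)) ⁻¹' Set.Ioi c = {ω | ∃ z, (ω, z) ∈ F ⁻¹' Set.Ioi c} := by
      ext ω
      simp [lt_iSup_iff]
    exact hset ▸ nullMeasurableSet_projection ν (hF measurableSet_Ioi)
  exact hnull.aemeasurable

end MeasurableSelection

/-! ### The σ-ring `atomSigma μ` -/

section SigmaFiniteRestrict

variable {Ω : Type*} [MeasurableSpace Ω] {μ : Measure Ω} {B : Set Ω}

lemma exists_cover_of_sigmaFinite_restrict (hB : MeasurableSet B)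
    (hfin : SigmaFinite (μ.restrict B)) :
    ∃ t : ℕ → Set Ω, (∀ n, MeasurableSet (t n)) ∧ (∀ n, μ (t n) < ∞) ∧ B = ⋃ n, t n := by
  refine ⟨fun n => spanningSets (μ.restrict B) n ∩ B,
    fun n => (measurableSet_spanningSets _ n).inter hB, fun n => ?_, ?_⟩
  · rw [← Measure.restrict_apply (measurableSet_spanningSets _ n)]
    exact measure_spanningSets_lt_top _ n
  · rw [← Set.iUnion_inter, iUnion_spanningSets, Set.univ_inter]

lemma sigmaFinite_restrict_of_cover {ι : Type*} [Countable ι] (hB : MeasurableSet B)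
    {t : ι → Set Ω} (ht : ∀ i, μ (t i) < ∞) (hBt : B ⊆ ⋃ i, t i) :
    SigmaFinite (μ.restrict B) := by
  refine Measure.sigmaFinite_of_countable (S := insert Bᶜ (Set.range t))
    ((Set.countable_range t).insert _) ?_ ?_
  · rintro s (rfl | ⟨i, rfl⟩)
    · simp [Measure.restrict_apply hB.compl]
    · exact (Measure.restrict_apply_le _ _).trans_lt (ht i)
  · rw [Set.sUnion_insert, Set.sUnion_range, ← Set.compl_subset_iff_union, compl_compl]
    exact hBt

lemma sigmaFinite_restrict_iUnion {ι : Type*} [Countable ι] {B : ι → Set Ω}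
    (hB : ∀ i, MeasurableSet (B i)) (hfin : ∀ i, SigmaFinite (μ.restrict (B i))) :
    SigmaFinite (μ.restrict (⋃ i, B i)) := by
  choose t _ htfin hBt using fun i => exists_cover_of_sigmaFinite_restrict (hB i) (hfin i)
  refine sigmaFinite_restrict_of_cover (t := fun p : ι × ℕ => t p.1 p.2) (.iUnion hB)
    (fun p => htfin p.1 p.2) (Set.iUnion_subset fun i => ?_)
  rw [hBt i]
  exact Set.iUnion_subset fun n => Set.subset_iUnion (fun p : ι × ℕ => t p.1 p.2) (i, n)

lemma sigmaFinite_restrict_union {B' : Set Ω} (hB : MeasurableSet B) (hB' : MeasurableSet B')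
    (hfin : SigmaFinite (μ.restrict B)) (hfin' : SigmaFinite (μ.restrict B')) :
    SigmaFinite (μ.restrict (B ∪ B')) := by
  rw [Set.union_eq_iUnion]
  exact sigmaFinite_restrict_iUnion (Bool.forall_bool.2 ⟨hB', hB⟩)
    (Bool.forall_bool.2 ⟨hfin', hfin⟩)

lemma sigmaFinite_restrict_sUnion_of_lt_top {C : Set (Set Ω)} (hC : C.Countable)
    (hCm : ∀ D ∈ C, MeasurableSet D) (hCfin : ∀ D ∈ C, μ D < ∞) :
    SigmaFinite (μ.restrict (⋃₀ C)) := by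
  have := hC.to_subtype
  exact sigmaFinite_restrict_of_cover (.sUnion hC hCm) (fun D : C => hCfin D D.2)
    Set.sUnion_eq_iUnion.subset

end SigmaFiniteRestrict

section AtomSigma

variable {Ω : Type*} [MeasurableSpace Ω] {μ : Measure Ω} {A B D E : Set Ω}

lemma measurableSet_of_mem_atomSigma (hA : A ∈ atomSigma μ) : MeasurableSet A := by
  obtain ⟨C, B, hC, hCa, hB, -, rfl⟩ := hA
  exact (MeasurableSet.sUnion hC fun D hD => (hCa D hD).1).union hB

lemma mem_atomSigma_of_sigmaFinite (hB : MeasurableSet B) (hfin : SigmaFinite (μ.restrict B)) :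
    B ∈ atomSigma μ :=
  ⟨∅, B, Set.countable_empty, by simp, hB, hfin, by simp⟩

lemma IsMeasureAtom.mem_atomSigma (hA : IsMeasureAtom μ A) : A ∈ atomSigma μ :=
  ⟨{A}, ∅, Set.countable_singleton A, by simpa, .empty,
    by rw [Measure.restrict_empty]; infer_instance, by simp⟩

lemma iUnion_mem_atomSigma {ι : Type*} [Countable ι] {A : ι → Set Ω}
    (hA : ∀ i, A i ∈ atomSigma μ) : ⋃ i, A i ∈ atomSigma μ := by
  choose C B hC hCa hB hfin hAe using hA
  refine ⟨⋃ i, C i, ⋃ i, B i, Set.countable_iUnion hC, fun D hD => ?_, .iUnion hB,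
    sigmaFinite_restrict_iUnion hB hfin, ?_⟩
  · obtain ⟨i, hi⟩ := Set.mem_iUnion.1 hD
    exact hCa i D hi
  · rw [Set.sUnion_iUnion, ← Set.iUnion_union_distrib]
    exact Set.iUnion_congr hAe

lemma union_mem_atomSigma (hA : A ∈ atomSigma μ) (hB : B ∈ atomSigma μ) :
    A ∪ B ∈ atomSigma μ := by
  rw [Set.union_eq_iUnion]
  exact iUnion_mem_atomSigma (Bool.forall_bool.2 ⟨hB, hA⟩)

instance : Nonempty (atomSigma μ) :=
  ⟨∅, mem_atomSigma_of_sigmaFinite .empty (by rw [Measure.restrict_empty]; infer_instance)⟩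

instance : IsDirectedOrder (atomSigma μ) where
  directed A B :=
    ⟨⟨A ∪ B, union_mem_atomSigma A.2 B.2⟩, Set.subset_union_left, Set.subset_union_right⟩

/-- `μ` takes no finite positive value on the measurable subsets of `D`: what remains of a set of
`atomSigma μ` after removing a suitable σ-finite part. -/
def IsZeroOrTopOn (μ : Measure Ω) (D : Set Ω) : Prop :=
  ∀ E, MeasurableSet E → E ⊆ D → μ E = 0 ∨ μ E = ∞

lemma IsZeroOrTopOn.mono (h : IsZeroOrTopOn μ D) (hED : E ⊆ D) : IsZeroOrTopOn μ E :=
  fun F hF hFE => h F hF (hFE.trans hED)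

lemma IsMeasureAtom.isZeroOrTopOn (hA : IsMeasureAtom μ A) (htop : μ A = ∞) :
    IsZeroOrTopOn μ A :=
  fun E hE hEA => htop ▸ hA.2.2 E hE hEA

lemma IsZeroOrTopOn.sUnion {C : Set (Set Ω)} (hC : C.Countable)
    (hCm : ∀ D ∈ C, MeasurableSet D) (hCμ : ∀ D ∈ C, IsZeroOrTopOn μ D) :
    IsZeroOrTopOn μ (⋃₀ C) := by
  intro E hE hEC
  by_cases htop : ∃ D ∈ C, μ (E ∩ D) = ∞
  · obtain ⟨D, _, hD⟩ := htop
    exact Or.inr (measure_mono_top Set.inter_subset_left hD)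
  · push Not at htop
    have hE' : E = ⋃ D ∈ C, E ∩ D := by
      rw [← Set.inter_iUnion₂, ← Set.sUnion_eq_biUnion, Set.inter_eq_self_of_subset_left hEC]
    rw [hE', measure_biUnion_null_iff hC]
    exact Or.inl fun D hD =>
      (hCμ D hD _ (hE.inter (hCm D hD)) Set.inter_subset_right).resolve_right (htop D hD)

lemma IsZeroOrTopOn.measure_eq_zero_or_isMeasureAtom (h : IsZeroOrTopOn μ D)
    (hD : MeasurableSet D) : μ D = 0 ∨ IsMeasureAtom μ D ∧ μ D = ∞ :=
  (h D hD subset_rfl).imp_right fun (htop : μ D = ∞) =>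
    ⟨⟨hD, by simp [htop], fun E hE hED => htop.symm ▸ h E hE hED⟩, htop⟩

lemma IsZeroOrTopOn.mem_atomSigma (h : IsZeroOrTopOn μ D) (hD : MeasurableSet D) :
    D ∈ atomSigma μ := by
  rcases h.measure_eq_zero_or_isMeasureAtom hD with h₀ | ⟨hatom, -⟩
  · refine mem_atomSigma_of_sigmaFinite hD ?_
    rw [Measure.restrict_eq_zero.2 h₀]
    infer_instance
  · exact hatom.mem_atomSigma

lemma exists_decomposition_of_mem_atomSigma (hA : A ∈ atomSigma μ) :
    ∃ D B : Set Ω, A = D ∪ B ∧ Disjoint D B ∧ MeasurableSet D ∧ IsZeroOrTopOn μ D ∧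
      MeasurableSet B ∧ SigmaFinite (μ.restrict B) := by
  obtain ⟨C, B, hC, hCa, hB, hfin, rfl⟩ := hA
  let Cfin : Set (Set Ω) := {D ∈ C | μ D < ∞}
  let Ctop : Set (Set Ω) := {D ∈ C | μ D = ∞}
  have hCfin : Cfin.Countable := hC.mono (Set.sep_subset _ _)
  have hCtop : Ctop.Countable := hC.mono (Set.sep_subset _ _)
  have hCfinm : ∀ D ∈ Cfin, MeasurableSet D := fun D hD => (hCa D hD.1).1
  have hCtopm : ∀ D ∈ Ctop, MeasurableSet D := fun D hD => (hCa D hD.1).1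
  have hsplit : C = Ctop ∪ Cfin := by
    ext D
    simp only [Ctop, Cfin, Set.mem_union, Set.mem_ofPred_eq, ← and_or_left, lt_top_iff_ne_top,
      eq_or_ne, and_true]
  have hB' : MeasurableSet (⋃₀ Cfin ∪ B) := (MeasurableSet.sUnion hCfin hCfinm).union hB
  refine ⟨⋃₀ Ctop \ (⋃₀ Cfin ∪ B), ⋃₀ Cfin ∪ B, ?_, Set.disjoint_sdiff_left,
    (MeasurableSet.sUnion hCtop hCtopm).diff hB', ?_, hB', ?_⟩
  · rw [Set.sdiff_union_self, ← Set.union_assoc, ← Set.sUnion_union, ← hsplit]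
  · exact (IsZeroOrTopOn.sUnion hCtop hCtopm fun D hD =>
      (hCa D hD.1).isZeroOrTopOn hD.2).mono Set.sdiff_subset
  · exact sigmaFinite_restrict_union (.sUnion hCfin hCfinm) hB
      (sigmaFinite_restrict_sUnion_of_lt_top hCfin hCfinm fun D hD => hD.2) hfin

lemma IsZeroOrTopOn.ae_eq_zero_of_lintegral_ne_top (hDμ : IsZeroOrTopOn μ D)
    (hD : MeasurableSet D) {p : Ω → ℝ≥0∞} (hp : AEMeasurable p (μ.restrict D))
    (hpi : ∫⁻ ω in D, p ω ∂μ ≠ ∞) : ∀ᵐ ω ∂μ.restrict D, p ω = 0 := by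
  rw [lintegral_congr_ae hp.ae_eq_mk] at hpi
  have hsmall : ∀ n : ℕ, ∀ᵐ ω ∂μ.restrict D, ¬ ((n : ℝ≥0∞) + 1)⁻¹ ≤ hp.mk p ω := by
    intro n
    have hm : MeasurableSet {ω | ((n : ℝ≥0∞) + 1)⁻¹ ≤ hp.mk p ω} :=
      measurableSet_le measurable_const hp.measurable_mk
    refine (measure_eq_zero_iff_ae_notMem (s := {ω | ((n : ℝ≥0∞) + 1)⁻¹ ≤ hp.mk p ω})).1 ?_
    have hmarkov := mul_meas_ge_le_lintegral₀ hp.measurable_mk.aemeasurable ((n : ℝ≥0∞) + 1)⁻¹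
      (μ := μ.restrict D)
    rw [Measure.restrict_apply hm] at hmarkov ⊢
    refine (hDμ _ (hm.inter hD) Set.inter_subset_right).resolve_right fun htop => ?_
    rw [htop, ENNReal.mul_top (by simp)] at hmarkov
    exact hpi (top_le_iff.1 hmarkov)
  filter_upwards [hp.ae_eq_mk, ae_all_iff.2 hsmall] with ω hmk hω
  rw [hmk]
  by_contra hne
  obtain ⟨n, hn⟩ := ENNReal.exists_inv_nat_lt hne
  exact hω n ((ENNReal.inv_le_inv.2 le_self_add).trans hn.le)

end AtomSigma

/-! ### The extended Lebesgue integral -/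

section ExtIntegral

open Classical in
/-- The difference of a positive and a negative part, with the convention `∞ - ∞ = ∞`. -/
def topSub (p n : ℝ≥0∞) : EReal :=
  if p = ∞ then ⊤ else (p : EReal) - n

lemma topSub_mono {p p' n n' : ℝ≥0∞} (hp : p ≤ p') (hn : n' ≤ n) : topSub p n ≤ topSub p' n' := by
  rw [topSub, topSub]
  split_ifs with h h' h'
  · exact le_rfl
  · exact absurd (top_le_iff.1 (h ▸ hp)) h'
  · exact le_top
  · exact EReal.sub_le_sub (EReal.coe_ennreal_le_coe_ennreal_iff.2 hp)
      (EReal.coe_ennreal_le_coe_ennreal_iff.2 hn)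

lemma topSub_coe (p n : NNReal) : topSub p n = ((p - n : ℝ) : EReal) := by
  rw [topSub, if_neg ENNReal.coe_ne_top, EReal.coe_sub]
  rfl

lemma topSub_coe_top (p : NNReal) : topSub p ∞ = ⊥ := by
  rw [topSub, if_neg ENNReal.coe_ne_top, EReal.coe_ennreal_top, EReal.sub_top]

lemma topSub_top (n : ℝ≥0∞) : topSub ∞ n = ⊤ :=
  if_pos rfl

lemma topSub_eq_top_iff {p n : ℝ≥0∞} : topSub p n = ⊤ ↔ p = ∞ := by
  induction p using ENNReal.recTopCoe <;> induction n using ENNReal.recTopCoe <;>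
    simp only [topSub_coe, topSub_coe_top, topSub_top, EReal.coe_ne_top, bot_ne_top,
      ENNReal.coe_ne_top]

lemma topSub_ne_bot_iff {p n : ℝ≥0∞} (hp : p ≠ ∞) : topSub p n ≠ ⊥ ↔ n ≠ ∞ := by
  lift p to NNReal using hp
  induction n using ENNReal.recTopCoe <;>
    simp only [topSub_coe, topSub_coe_top, EReal.coe_ne_bot, ENNReal.coe_ne_top, ne_eq,
      not_true_eq_false, not_false_eq_true]

lemma topSub_swap {p n : ℝ≥0∞} (hp : p ≠ ∞) : topSub n p = -topSub p n := by
  lift p to NNReal using hp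
  induction n using ENNReal.recTopCoe with
  | top => rw [topSub_top, topSub_coe_top, EReal.neg_bot]
  | coe n => rw [topSub_coe, topSub_coe, ← EReal.coe_neg, neg_sub]

variable {Ω : Type*} [MeasurableSpace Ω] {ν : Measure Ω} {g h : Ω → EReal} {p : Ω → ℝ}

/-- The extended Lebesgue integral, with the convention `∞ - ∞ = ∞`. -/
def extIntegral (ν : Measure Ω) (g : Ω → EReal) : EReal :=
  topSub (∫⁻ ω, (g ω).toENNReal ∂ν) (∫⁻ ω, (-g ω).toENNReal ∂ν)

lemma extIntegral_mono (hgh : g ≤ᵐ[ν] h) : extIntegral ν g ≤ extIntegral ν h :=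
  topSub_mono (lintegral_mono_ae (hgh.mono fun _ hω => EReal.toENNReal_le_toENNReal hω))
    (lintegral_mono_ae (hgh.mono fun _ hω =>
      EReal.toENNReal_le_toENNReal (EReal.neg_le_neg_iff.2 hω)))

lemma extIntegral_congr (hgh : g =ᵐ[ν] h) : extIntegral ν g = extIntegral ν h :=
  le_antisymm (extIntegral_mono hgh.le) (extIntegral_mono hgh.symm.le)

lemma extIntegral_eq_top_iff : extIntegral ν g = ⊤ ↔ ∫⁻ ω, (g ω).toENNReal ∂ν = ∞ :=
  topSub_eq_top_iff

lemma extIntegral_ne_bot_iff (hg : ∫⁻ ω, (g ω).toENNReal ∂ν ≠ ∞) :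
    extIntegral ν g ≠ ⊥ ↔ ∫⁻ ω, (-g ω).toENNReal ∂ν ≠ ∞ :=
  topSub_ne_bot_iff hg

lemma extIntegral_neg (hg : extIntegral ν g ≠ ⊤) :
    extIntegral ν (fun ω => -g ω) = -extIntegral ν g := by
  simp only [extIntegral, neg_neg]
  exact topSub_swap (mt extIntegral_eq_top_iff.2 hg)

lemma extIntegral_coe (hp : Integrable p ν) :
    extIntegral ν (fun ω => (p ω : EReal)) = ((∫ ω, p ω ∂ν : ℝ) : EReal) := by
  have hpos : ∫⁻ ω, (p ω : EReal).toENNReal ∂ν ≠ ∞ := hp.lintegral_lt_top.ne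
  have hneg : ∫⁻ ω, (-(p ω : EReal)).toENNReal ∂ν ≠ ∞ := hp.neg.lintegral_lt_top.ne
  rw [extIntegral, topSub, if_neg hpos, ← EReal.coe_ennreal_toReal hpos,
    ← EReal.coe_ennreal_toReal hneg, ← EReal.coe_sub,
    integral_eq_lintegral_pos_part_sub_lintegral_neg_part hp]
  rfl

lemma extIntegral_coe_ennreal (s : Ω → ℝ≥0∞) :
    extIntegral ν (fun ω => (s ω : EReal)) = ((∫⁻ ω, s ω ∂ν : ℝ≥0∞) : EReal) := by
  have hneg : ∀ ω, (-(s ω : EReal)).toENNReal = 0 := fun ω =>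
    EReal.toENNReal_of_nonpos (EReal.neg_le_zero.2 (EReal.coe_ennreal_nonneg _))
  simp only [extIntegral, EReal.toENNReal_coe, hneg, lintegral_zero, topSub]
  split_ifs with htop <;> simp [htop]

lemma exists_integrable_of_extIntegral_finite (hg : AEMeasurable g ν) (ht : extIntegral ν g ≠ ⊤)
    (hb : extIntegral ν g ≠ ⊥) :
    ∃ p : Ω → ℝ, Integrable p ν ∧ g =ᵐ[ν] fun ω => (p ω : EReal) := by
  have hpos : ∫⁻ ω, (g ω).toENNReal ∂ν ≠ ∞ := mt extIntegral_eq_top_iff.2 ht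
  have hneg : ∫⁻ ω, (-g ω).toENNReal ∂ν ≠ ∞ := (extIntegral_ne_bot_iff hpos).1 hb
  have hfin : g =ᵐ[ν] fun ω => ((g ω).toReal : EReal) := by
    filter_upwards [ae_lt_top' hg.ereal_toENNReal hpos, ae_lt_top' hg.neg.ereal_toENNReal hneg]
      with ω hω hω'
    refine (EReal.coe_toReal (EReal.toENNReal_ne_top_iff.1 hω.ne) fun hbot => ?_).symm
    simp [hbot] at hω'
  refine ⟨fun ω => (g ω).toReal, ⟨hg.ereal_toReal.aestronglyMeasurable, ?_⟩, hfin⟩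
  calc ∫⁻ ω, ‖(g ω).toReal‖ₑ ∂ν ≤ ∫⁻ ω, ((g ω).toENNReal + (-g ω).toENNReal) ∂ν := by
        refine lintegral_mono_ae (hfin.mono fun ω hω => ?_)
        rw [hω]
        simp only [EReal.toReal_coe, ← EReal.coe_neg, EReal.real_coe_toENNReal]
        rw [Real.enorm_eq_ofReal_abs]
        rcases abs_cases (g ω).toReal with ⟨h, -⟩ | ⟨h, -⟩ <;> rw [h]
        exacts [le_self_add, le_add_self]
    _ = _ := lintegral_add_left' hg.ereal_toENNReal _
    _ < ∞ := ENNReal.add_lt_top.2 ⟨hpos.lt_top, hneg.lt_top⟩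

lemma ae_eq_of_extIntegral_eq (hg : AEMeasurable g ν) (hh : AEMeasurable h ν) (hgh : g ≤ᵐ[ν] h)
    (heq : extIntegral ν g = extIntegral ν h) (ht : extIntegral ν g ≠ ⊤)
    (hb : extIntegral ν g ≠ ⊥) : g =ᵐ[ν] h := by
  obtain ⟨p, hp, hgp⟩ := exists_integrable_of_extIntegral_finite hg ht hb
  obtain ⟨q, hq, hhq⟩ := exists_integrable_of_extIntegral_finite hh (heq ▸ ht) (heq ▸ hb)
  rw [extIntegral_congr hgp, extIntegral_congr hhq, extIntegral_coe hp, extIntegral_coe hq,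
    EReal.coe_eq_coe_iff] at heq
  have hpq : p ≤ᵐ[ν] q := by
    filter_upwards [hgp, hhq, hgh] with ω hgω hhω hle
    exact EReal.coe_le_coe_iff.1 (hgω ▸ hhω ▸ hle)
  filter_upwards [hgp, hhq, (integral_eq_iff_of_ae_le hp hq hpq).1 heq] with ω hgω hhω hω
  rw [hgω, hhω, hω]

lemma lintegral_toENNReal_ne_top_of_le_coe_add (hp : Integrable p ν)
    (hgh : ∀ ω, g ω ≤ (p ω : EReal) + h ω) (hh : ∫⁻ ω, (h ω).toENNReal ∂ν ≠ ∞) :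
    ∫⁻ ω, (g ω).toENNReal ∂ν ≠ ∞ := by
  refine ne_top_of_le_ne_top (ENNReal.add_ne_top.2 ⟨hp.lintegral_lt_top.ne, hh⟩) ?_
  rw [← lintegral_add_left' hp.aestronglyMeasurable.aemeasurable.ennreal_ofReal]
  exact lintegral_mono fun ω =>
    (EReal.toENNReal_le_toENNReal (hgh ω)).trans EReal.toENNReal_add_le

lemma lintegral_toENNReal_coe_add_eq_top_iff (hp : Integrable p ν) :
    ∫⁻ ω, ((p ω : EReal) + h ω).toENNReal ∂ν = ∞ ↔ ∫⁻ ω, (h ω).toENNReal ∂ν = ∞ := by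
  refine not_iff_not.1 ⟨lintegral_toENNReal_ne_top_of_le_coe_add hp.neg fun ω => ?_,
    lintegral_toENNReal_ne_top_of_le_coe_add hp fun ω => le_rfl⟩
  rw [← add_assoc, Pi.neg_apply, ← EReal.coe_add, neg_add_cancel, EReal.coe_zero, zero_add]

lemma extIntegral_coe_add (hp : Integrable p ν) (hh : AEMeasurable h ν) :
    extIntegral ν (fun ω => (p ω : EReal) + h ω) =
      ((∫ ω, p ω ∂ν : ℝ) : EReal) + extIntegral ν h := by
  by_cases ht : extIntegral ν h = ⊤
  · rw [ht, EReal.coe_add_top, extIntegral_eq_top_iff, lintegral_toENNReal_coe_add_eq_top_iff hp]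
    exact extIntegral_eq_top_iff.1 ht
  by_cases hb : extIntegral ν h = ⊥
  · have hpos : ∫⁻ ω, (h ω).toENNReal ∂ν ≠ ∞ := mt extIntegral_eq_top_iff.2 ht
    rw [hb, EReal.add_bot]
    by_contra hne
    have hpos' := (lintegral_toENNReal_coe_add_eq_top_iff hp).not.2 hpos
    refine (extIntegral_ne_bot_iff hpos).2 ?_ hb
    rw [← Ne, extIntegral_ne_bot_iff hpos'] at hne
    have hneg : ∀ ω, -((p ω : EReal) + h ω) = ((-p ω : ℝ) : EReal) + -h ω := fun ω => by
      rw [EReal.neg_add (by simp) (by simp), EReal.coe_neg, sub_eq_add_neg]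
    simp only [hneg] at hne
    exact (lintegral_toENNReal_coe_add_eq_top_iff hp.neg).not.1 hne
  · obtain ⟨q, hq, hhq⟩ := exists_integrable_of_extIntegral_finite hh ht hb
    have hpq : (fun ω => (p ω : EReal) + h ω) =ᵐ[ν] fun ω => ((p ω + q ω : ℝ) : EReal) :=
      hhq.mono fun ω hω => by simp [hω]
    rw [extIntegral_congr hpq, extIntegral_congr hhq, extIntegral_coe hq, ← EReal.coe_add,
      ← integral_add hp hq]
    exact extIntegral_coe (hp.add hq)

end ExtIntegral

/-! ### The exhausting integral -/

section ExhaustingIntegral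

lemma exists_forall_le_of_forall_seq {ι β : Type*} [Nonempty ι] [CompleteLinearOrder β]
    [TopologicalSpace β] [OrderTopology β] [FirstCountableTopology β] (F : ι → β)
    (h : ∀ x : ℕ → ι, ∃ j, ∀ n, F (x n) ≤ F j) : ∃ j, ∀ i, F i ≤ F j := by
  obtain ⟨u, -, hu, huF⟩ := exists_seq_tendsto_sSup (Set.range_nonempty F) (OrderTop.bddAbove _)
  choose x hx using huF
  obtain ⟨j, hj⟩ := h x
  exact ⟨j, fun i => (le_sSup (Set.mem_range_self i)).trans
    (le_of_tendsto' hu fun n => (hx n).symm.le.trans (hj n))⟩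

variable {Ω : Type*} [MeasurableSpace Ω] {μ : Measure Ω} {α β : Set Ω → Ω → EReal} {A B : Set Ω}

lemma exhIntegralFam_eq_topSub (α : Set Ω → Ω → EReal) :
    exhIntegralFam μ α = topSub (exhLIntegralFam μ α) (exhLIntegralFam μ fun A ω => -α A ω) :=
  rfl

lemma exhLIntegralFam_mono (hle : ∀ A ∈ atomSigma μ, α A ≤ᵐ[μ.restrict A] β A) :
    exhLIntegralFam μ α ≤ exhLIntegralFam μ β :=
  iSup₂_mono fun A hA => lintegral_mono_ae ((hle A hA).mono fun _ hω =>
    EReal.toENNReal_le_toENNReal hω)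

lemma exhIntegralFam_mono (hle : ∀ A ∈ atomSigma μ, α A ≤ᵐ[μ.restrict A] β A) :
    exhIntegralFam μ α ≤ exhIntegralFam μ β :=
  topSub_mono (exhLIntegralFam_mono hle) (exhLIntegralFam_mono fun A hA =>
    (hle A hA).mono fun _ hω => EReal.neg_le_neg_iff.2 hω)

lemma exhIntegralFam_congr (heq : ∀ A ∈ atomSigma μ, α A =ᵐ[μ.restrict A] β A) :
    exhIntegralFam μ α = exhIntegralFam μ β :=
  le_antisymm (exhIntegralFam_mono fun A hA => (heq A hA).le)
    (exhIntegralFam_mono fun A hA => (heq A hA).symm.le)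

lemma setLIntegral_le_exhLIntegralFam (α : Set Ω → Ω → EReal) (hA : A ∈ atomSigma μ) :
    ∫⁻ ω in A, (α A ω).toENNReal ∂μ ≤ exhLIntegralFam μ α :=
  le_iSup₂ (f := fun A (_ : A ∈ atomSigma μ) => ∫⁻ ω in A, (α A ω).toENNReal ∂μ) A hA

lemma extIntegral_restrict_ne_top (ht : exhIntegralFam μ α ≠ ⊤) (hA : A ∈ atomSigma μ) :
    extIntegral (μ.restrict A) (α A) ≠ ⊤ :=
  mt extIntegral_eq_top_iff.1 <|
    ne_top_of_le_ne_top (mt topSub_eq_top_iff.2 ht) (setLIntegral_le_exhLIntegralFam α hA)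

lemma exhLIntegralFam_neg_ne_top (ht : exhIntegralFam μ α ≠ ⊤) (hb : exhIntegralFam μ α ≠ ⊥) :
    exhLIntegralFam μ (fun A ω => -α A ω) ≠ ∞ :=
  (topSub_ne_bot_iff (mt topSub_eq_top_iff.2 ht)).1 hb

lemma extIntegral_restrict_ne_bot (ht : exhIntegralFam μ α ≠ ⊤) (hb : exhIntegralFam μ α ≠ ⊥)
    (hA : A ∈ atomSigma μ) : extIntegral (μ.restrict A) (α A) ≠ ⊥ :=
  (extIntegral_ne_bot_iff (mt extIntegral_eq_top_iff.2 (extIntegral_restrict_ne_top ht hA))).2 <|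
    ne_top_of_le_ne_top (exhLIntegralFam_neg_ne_top ht hb)
      (setLIntegral_le_exhLIntegralFam (fun A ω => -α A ω) hA)

/-- The members of the family `α` agree a.e. on common sets of `atomSigma μ`. -/
def IsConsistent (μ : Measure Ω) (α : Set Ω → Ω → EReal) : Prop :=
  ∀ A ∈ atomSigma μ, ∀ B ∈ atomSigma μ, A ⊆ B → α A =ᵐ[μ.restrict A] α B

lemma isConsistent_const (φ : Ω → EReal) : IsConsistent μ (fun _ => φ) :=
  fun _ _ _ _ _ => Filter.EventuallyEq.rfl

lemma IsConsistent.neg (hα : IsConsistent μ α) : IsConsistent μ (fun A ω => -α A ω) :=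
  fun A hA B hB hAB => (hα A hA B hB hAB).mono fun _ hω => congrArg Neg.neg hω

lemma IsConsistent.setLIntegral_eq (hα : IsConsistent μ α) (hA : A ∈ atomSigma μ)
    (hB : B ∈ atomSigma μ) (hAB : A ⊆ B) :
    ∫⁻ ω in A, (α A ω).toENNReal ∂μ = ∫⁻ ω in A, (α B ω).toENNReal ∂μ :=
  lintegral_congr_ae ((hα A hA B hB hAB).mono fun _ hω => congrArg EReal.toENNReal hω)

lemma IsConsistent.setLIntegral_mono (hα : IsConsistent μ α) (hA : A ∈ atomSigma μ)
    (hB : B ∈ atomSigma μ) (hAB : A ⊆ B) :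
    ∫⁻ ω in A, (α A ω).toENNReal ∂μ ≤ ∫⁻ ω in B, (α B ω).toENNReal ∂μ :=
  (hα.setLIntegral_eq hA hB hAB).trans_le (lintegral_mono_set hAB)

/-- Since `atomSigma μ` is closed under countable unions, an exhausting integral is attained. -/
lemma IsConsistent.eventually_exhLIntegralFam_eq (hα : IsConsistent μ α) :
    ∀ᶠ A : atomSigma μ in Filter.atTop,
      exhLIntegralFam μ α = ∫⁻ ω in A, (α A ω).toENNReal ∂μ := by
  obtain ⟨A, hA⟩ := exists_forall_le_of_forall_seq
    (fun A : atomSigma μ => ∫⁻ ω in A, (α A ω).toENNReal ∂μ) fun x =>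
      ⟨⟨⋃ n, x n, iUnion_mem_atomSigma fun n => (x n).2⟩, fun n =>
        hα.setLIntegral_mono (x n).2 (iUnion_mem_atomSigma fun n => (x n).2)
          (Set.subset_iUnion (fun n => (x n : Set Ω)) n)⟩
  filter_upwards [Filter.eventually_ge_atTop A] with B hAB
  exact le_antisymm
    (iSup₂_le fun C hC => (hA ⟨C, hC⟩).trans (hα.setLIntegral_mono A.2 B.2 hAB))
    (setLIntegral_le_exhLIntegralFam α B.2)

lemma IsConsistent.eventually_exhIntegralFam_eq (hα : IsConsistent μ α) :
    ∀ᶠ A : atomSigma μ in Filter.atTop,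
      exhIntegralFam μ α = extIntegral (μ.restrict A) (α A) := by
  filter_upwards [hα.eventually_exhLIntegralFam_eq, hα.neg.eventually_exhLIntegralFam_eq]
    with A hpos hneg
  rw [exhIntegralFam_eq_topSub, hpos, hneg, extIntegral]

lemma eventually_exhIntegral_eq (φ : Ω → EReal) :
    ∀ᶠ A : atomSigma μ in Filter.atTop, exhIntegral μ φ = extIntegral (μ.restrict A) φ :=
  (isConsistent_const φ).eventually_exhIntegralFam_eq

lemma setLIntegral_sdiff_eq_zero_of_le {p : Ω → ℝ≥0∞} (hA : MeasurableSet A) (hAB : A ⊆ B)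
    (hle : ∫⁻ ω in B, p ω ∂μ ≤ ∫⁻ ω in A, p ω ∂μ) (hp : ∫⁻ ω in A, p ω ∂μ ≠ ∞) :
    ∫⁻ ω in B \ A, p ω ∂μ = 0 := by
  have h := lintegral_inter_add_sdiff p B hA (μ := μ)
  rw [Set.inter_eq_self_of_subset_right hAB] at h
  exact nonpos_iff_eq_zero.1 ((ENNReal.add_le_add_iff_left hp).1 (by simpa [h] using hle))

lemma IsConsistent.eventually_toENNReal_eq_zero (hα : IsConsistent μ α)
    (hm : ∀ A ∈ atomSigma μ, AEMeasurable (α A) (μ.restrict A))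
    (ht : exhLIntegralFam μ α ≠ ∞) :
    ∀ᶠ A : atomSigma μ in Filter.atTop, ∀ B ≥ A,
      ∀ᵐ ω ∂μ.restrict B, ω ∉ A.1 → (α B ω).toENNReal = 0 := by
  filter_upwards [Filter.eventually_forall_ge_atTop.2 hα.eventually_exhLIntegralFam_eq]
    with A hA B hAB
  have hAm := measurableSet_of_mem_atomSigma A.2
  have hBm := measurableSet_of_mem_atomSigma B.2
  have hAα := (hA A le_rfl).trans (hα.setLIntegral_eq A.2 B.2 hAB)
  have hnull : ∫⁻ ω in B \ A, (α B ω).toENNReal ∂μ = 0 :=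
    setLIntegral_sdiff_eq_zero_of_le hAm hAB (by rw [← hA B hAB, ← hAα]) (hAα ▸ ht)
  rw [lintegral_eq_zero_iff' ((hm B B.2).mono_set Set.sdiff_subset).ereal_toENNReal,
    Filter.EventuallyEq, ae_restrict_iff' (hBm.diff hAm)] at hnull
  rw [ae_restrict_iff' hBm]
  filter_upwards [hnull] with ω hω hωB hωA using hω ⟨hωB, hωA⟩

lemma IsConsistent.eventually_eq_zero (hα : IsConsistent μ α)
    (hm : ∀ A ∈ atomSigma μ, AEMeasurable (α A) (μ.restrict A))
    (ht : exhIntegralFam μ α ≠ ⊤) (hb : exhIntegralFam μ α ≠ ⊥) :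
    ∀ᶠ A : atomSigma μ in Filter.atTop, ∀ B ≥ A, ∀ᵐ ω ∂μ.restrict B, ω ∉ A.1 → α B ω = 0 := by
  filter_upwards [hα.eventually_toENNReal_eq_zero hm (mt topSub_eq_top_iff.2 ht),
    hα.neg.eventually_toENNReal_eq_zero (fun A hA => (hm A hA).neg)
      (exhLIntegralFam_neg_ne_top ht hb)] with A hpos hneg B hAB
  filter_upwards [hpos B hAB, hneg B hAB] with ω hω hω' hωA
  exact le_antisymm (EReal.toENNReal_eq_zero_iff.1 (hω hωA))
    (EReal.neg_le_zero.1 (EReal.toENNReal_eq_zero_iff.1 (hω' hωA)))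

lemma ae_eq_of_exhIntegralFam_eq (hα : IsConsistent μ α) (hβ : IsConsistent μ β)
    (hαm : ∀ A ∈ atomSigma μ, AEMeasurable (α A) (μ.restrict A))
    (hβm : ∀ A ∈ atomSigma μ, AEMeasurable (β A) (μ.restrict A))
    (hle : ∀ A ∈ atomSigma μ, α A ≤ᵐ[μ.restrict A] β A)
    (heq : exhIntegralFam μ α = exhIntegralFam μ β) (ht : exhIntegralFam μ α ≠ ⊤)
    (hb : exhIntegralFam μ α ≠ ⊥) (hA : A ∈ atomSigma μ) : α A =ᵐ[μ.restrict A] β A := by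
  obtain ⟨B, hBα, hBβ, hAB⟩ := (hα.eventually_exhIntegralFam_eq.and
    (hβ.eventually_exhIntegralFam_eq.and (Filter.eventually_ge_atTop ⟨A, hA⟩))).exists
  have hB : α B =ᵐ[μ.restrict B] β B :=
    ae_eq_of_extIntegral_eq (hαm B B.2) (hβm B B.2) (hle B B.2) (hBα ▸ hBβ ▸ heq) (hBα ▸ ht)
      (hBα ▸ hb)
  filter_upwards [hα A hA B B.2 hAB, ae_restrict_of_ae_restrict_of_subset hAB hB,
    hβ A hA B B.2 hAB] with ω hωα hω hωβ
  rw [hωα, hω, hωβ]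

lemma exhIntegral_add_setLIntegral_le {φ ψ : Ω → EReal} {s : Ω → ℝ≥0∞}
    (hφ : ∀ A ∈ atomSigma μ, AEMeasurable φ (μ.restrict A)) (hs : Measurable s)
    (ht : exhIntegral μ φ ≠ ⊤) (hb : exhIntegral μ φ ≠ ⊥) (hA : A ∈ atomSigma μ)
    (hle : IAE μ fun ω => φ ω + (A.indicator s ω : ℝ≥0∞) ≤ ψ ω) :
    exhIntegral μ φ + (∫⁻ ω in A, s ω ∂μ : ℝ≥0∞) ≤ exhIntegral μ ψ := by
  obtain ⟨B, hBφ, hBψ, hAB⟩ := ((eventually_exhIntegral_eq φ).and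
    ((eventually_exhIntegral_eq ψ).and (Filter.eventually_ge_atTop ⟨A, hA⟩))).exists
  have hAm := measurableSet_of_mem_atomSigma hA
  obtain ⟨p, hp, hφp⟩ :=
    exists_integrable_of_extIntegral_finite (hφ B B.2) (hBφ ▸ ht) (hBφ ▸ hb)
  have hsA : ∫⁻ ω in A, s ω ∂μ = ∫⁻ ω in B, A.indicator s ω ∂μ := by
    rw [lintegral_indicator hAm, Measure.restrict_restrict hAm,
      Set.inter_eq_self_of_subset_left hAB]
  rw [hBφ, hBψ, extIntegral_congr hφp, extIntegral_coe hp, hsA, ← extIntegral_coe_ennreal,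
    ← extIntegral_coe_add hp (hs.indicator hAm).aemeasurable.coe_ereal_ennreal]
  refine extIntegral_mono ?_
  filter_upwards [hle B B.2, hφp] with ω hω hpω
  exact hpω ▸ hω

end ExhaustingIntegral

/-! ### Measurability of the integrands -/

section Measurability

variable {Ω : Type*} [MeasurableSpace Ω] {μ : Measure Ω} {A B : Set Ω}

lemma sigmaFinite_comap_subtype_coe (hB : MeasurableSet B) [SigmaFinite (μ.restrict B)] :
    SigmaFinite (μ.comap ((↑) : B → Ω)) := by
  refine SigmaFinite.of_map _ measurable_subtype_coe.aemeasurable ?_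
  rwa [map_comap_subtype_coe hB]

lemma measurable_superposition {X β : Type*} [TopologicalSpace X]
    [PseudoMetrizableSpace X] [MeasurableSpace X] [BorelSpace X] [MeasurableSpace β]
    {F : Ω → X → β}
    (hF : ∀ W : Set X, IsSeparable W → Measurable (fun p : A × W => F (p.1 : Ω) (p.2 : X)))
    {u : Ω → X} (hu : StronglyMeasurable (fun ω : A => u ω)) :
    Measurable (fun ω : A => F ω (u ω)) := by
  have hu' : Measurable fun ω : A =>
      (⟨u ω, Set.mem_range_self ω⟩ : Set.range fun ω : A => u ω) := hu.measurable.subtype_mk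
  exact (hF _ hu.isSeparable_range).comp (measurable_id.prodMk hu')

lemma polishSpace_of_isClosed_of_isSeparable {E : Type*} [MetricSpace E] [CompleteSpace E]
    {W : Set E} (hWc : IsClosed W) (hW : IsSeparable W) : PolishSpace W := by
  have := hW.separableSpace
  have := UniformSpace.secondCountable_of_separable W
  have := hWc.isComplete.completeSpace_coe
  infer_instance

variable {X : Type*} [NormedAddCommGroup X] {f : Ω → X → EReal} {u : Ω → X}

lemma IntegrallyStronglyMeasurable.isSeparable_image (hu : IntegrallyStronglyMeasurable μ u)
    (hA : A ∈ atomSigma μ) : IsSeparable (u '' A) := by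
  rw [Set.image_eq_range]
  exact (hu A hA).isSeparable_range

variable [MeasurableSpace X] [BorelSpace X]

lemma aemeasurable_integrand [NormedSpace ℝ X] (hf : IntegrallySeparablyMeasurable μ f)
    (hu : IntegrallyStronglyMeasurable μ u) (hA : A ∈ atomSigma μ) :
    AEMeasurable (fun ω => f ω (u ω)) (μ.restrict A) :=
  aemeasurable_restrict_of_measurable_subtype (measurableSet_of_mem_atomSigma hA)
    (measurable_superposition (hf A hA) (hu A hA))

variable [NormedSpace ℝ X] {v : Ω → X →L[ℝ] ℝ} {W : Set X}

lemma measurable_apply_prod (hv : IntegrallyWeakStarMeasurable μ v) (hA : A ∈ atomSigma μ)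
    (hW : IsSeparable W) : Measurable (fun p : A × W => v (p.1 : Ω) (p.2 : X)) := by
  have := hW.separableSpace
  have := UniformSpace.secondCountable_of_separable W
  have hvW := measurable_uncurry_of_continuous_of_measurable
    (u := fun (x : W) (ω : A) => v (ω : Ω) (x : X))
    (fun ω => (v ω).continuous.comp continuous_subtype_val) (fun x => hv A hA x)
  exact hvW.comp measurable_swap

lemma aemeasurable_apply (hv : IntegrallyWeakStarMeasurable μ v)
    (hu : IntegrallyStronglyMeasurable μ u) (hA : A ∈ atomSigma μ) :
    AEMeasurable (fun ω => v ω (u ω)) (μ.restrict A) :=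
  aemeasurable_restrict_of_measurable_subtype (measurableSet_of_mem_atomSigma hA)
    (measurable_superposition (F := fun ω x => v ω x)
      (fun _ hW => measurable_apply_prod hv hA hW) (hu A hA))

/-- The integrand `ω ↦ ⟨v(ω), u(ω)⟩ - f(ω, u(ω))` of `⟨u, v⟩ - I_f(u)`. -/
def conjugateIntegrand (f : Ω → X → EReal) (v : Ω → X →L[ℝ] ℝ) (u : Ω → X) (ω : Ω) : EReal :=
  ((v ω (u ω) : ℝ) : EReal) - f ω (u ω)

lemma aemeasurable_conjugateIntegrand (hf : IntegrallySeparablyMeasurable μ f)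
    (hv : IntegrallyWeakStarMeasurable μ v) (hu : IntegrallyStronglyMeasurable μ u)
    (hA : A ∈ atomSigma μ) : AEMeasurable (conjugateIntegrand f v u) (μ.restrict A) :=
  (aemeasurable_apply hv hu hA).coe_real_ereal.sub (aemeasurable_integrand hf hu hA)

lemma measurable_coe_sub_prod (hf : IntegrallySeparablyMeasurable μ f)
    (hv : IntegrallyWeakStarMeasurable μ v) (hA : A ∈ atomSigma μ) (hW : IsSeparable W) :
    Measurable fun p : A × W => ((v p.1 p.2 : ℝ) : EReal) - f p.1 p.2 :=
  (measurable_apply_prod hv hA hW).coe_real_ereal.sub (hf A hA W hW)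

lemma aemeasurable_conjugateOn [CompleteSpace X] (hf : IntegrallySeparablyMeasurable μ f)
    (hv : IntegrallyWeakStarMeasurable μ v) (hB : MeasurableSet B)
    [hfin : SigmaFinite (μ.restrict B)] (hWc : IsClosed W) (hW : IsSeparable W) :
    AEMeasurable (fun ω => conjugateOn (f ω) W (v ω)) (μ.restrict B) := by
  have := polishSpace_of_isClosed_of_isSeparable hWc hW
  have := sigmaFinite_comap_subtype_coe (μ := μ) hB
  rw [← map_comap_subtype_coe hB, (MeasurableEmbedding.subtype_coe hB).aemeasurable_map_iff]
  convert aemeasurable_iSup_of_polishSpace (μ.comap ((↑) : B → Ω))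
    (measurable_coe_sub_prod hf hv (mem_atomSigma_of_sigmaFinite hB hfin) hW) using 2 with ω
  exact (iSup_subtype (p := (· ∈ W)) (f := fun x => ((v ω x : ℝ) : EReal) - f ω x)).symm

lemma exists_stronglyMeasurable_lt_conjugateIntegrand [CompleteSpace X]
    (hf : IntegrallySeparablyMeasurable μ f) (hv : IntegrallyWeakStarMeasurable μ v)
    (hB : MeasurableSet B) [hfin : SigmaFinite (μ.restrict B)] (hWc : IsClosed W)
    (hW : IsSeparable W) {g : Ω → EReal} (hg : Measurable g) :
    ∃ u : Ω → X, StronglyMeasurable u ∧ ∀ᵐ ω ∂μ.restrict B,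
      g ω < conjugateOn (f ω) W (v ω) → g ω < conjugateIntegrand f v u ω := by
  rcases W.eq_empty_or_nonempty with rfl | hWn
  · exact ⟨0, stronglyMeasurable_zero, by simp [conjugateOn]⟩
  have := polishSpace_of_isClosed_of_isSeparable hWc hW
  have := sigmaFinite_comap_subtype_coe (μ := μ) hB
  have := hWn.to_subtype
  obtain ⟨s, hs, hsG⟩ := exists_measurable_selection (μ.comap ((↑) : B → Ω)) <|
    measurableSet_lt (hg.comp (measurable_subtype_coe.comp measurable_fst))
      (measurable_coe_sub_prod hf hv (mem_atomSigma_of_sigmaFinite hB hfin) hW)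
  obtain ⟨t, ht, hts⟩ := (MeasurableEmbedding.subtype_coe hB).exists_measurable_extend hs
    fun _ => inferInstance
  refine ⟨fun ω => t ω, continuous_subtype_val.comp_stronglyMeasurable ht.stronglyMeasurable, ?_⟩
  rw [ae_restrict_iff_subtype hB]
  filter_upwards [hsG] with ω hω hlt
  obtain ⟨x, hx⟩ := lt_iSup_iff.1 hlt
  obtain ⟨hxW, hx⟩ := lt_iSup_iff.1 hx
  rw [conjugateIntegrand, show t ω = s ω from congrFun hts ω]
  exact hω ⟨⟨x, hxW⟩, hx⟩

end Measurability

/-! ### Separable sets realizing the essential supremum -/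

section EssentialMaximum

section ConjugateOn

variable {X : Type*} [NormedAddCommGroup X] [NormedSpace ℝ X] {W W' : Set X}

lemma conjugateOn_mono (g : X → EReal) (h : W ⊆ W') (x' : X →L[ℝ] ℝ) :
    conjugateOn g W x' ≤ conjugateOn g W' x' :=
  biSup_mono fun _ hx => h hx

lemma le_conjugateOn (g : X → EReal) {x : X} (hx : x ∈ W) (x' : X →L[ℝ] ℝ) :
    ((x' x : ℝ) : EReal) - g x ≤ conjugateOn g W x' :=
  le_iSup₂ (f := fun x (_ : x ∈ W) => ((x' x : ℝ) : EReal) - g x) x hx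

lemma conjugateOn_univ (g : X → EReal) (x' : X →L[ℝ] ℝ) :
    conjugateOn g Set.univ x' = conjugate g x' := by
  simp only [conjugateOn, conjugate, Set.mem_univ, iSup_pos]

lemma conjugateOn_le_conjugate (g : X → EReal) (x' : X →L[ℝ] ℝ) :
    conjugateOn g W x' ≤ conjugate g x' :=
  conjugateOn_univ g x' ▸ conjugateOn_mono g (Set.subset_univ W) x'

end ConjugateOn

/-- A strictly increasing map of the extended reals into `[0, 1]`, which turns extended real
functions into integrable ones without losing strict inequalities. -/
def logistic (x : EReal) : ℝ≥0∞ := (1 + EReal.exp (-x))⁻¹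

lemma logistic_strictMono : StrictMono logistic := fun _ _ hxy =>
  ENNReal.inv_lt_inv.2 <| ENNReal.add_lt_add_left ENNReal.one_ne_top <|
    EReal.exp_strictMono (EReal.neg_lt_neg_iff.2 hxy)

lemma logistic_le_one (x : EReal) : logistic x ≤ 1 :=
  ENNReal.inv_le_one.2 le_self_add

lemma measurable_logistic : Measurable logistic :=
  logistic_strictMono.monotone.measurable

variable {Ω X : Type*} [MeasurableSpace Ω] {μ : Measure Ω} [NormedAddCommGroup X]
  [NormedSpace ℝ X] {f : Ω → X → EReal} {u : Ω → X} {v : Ω → X →L[ℝ] ℝ} {A B D : Set Ω}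
  {W : Set X}

section SigmaFinite

variable [MeasurableSpace X] [BorelSpace X] [CompleteSpace X]

lemma exists_forall_conjugateOn_le_of_sigmaFinite (hf : IntegrallySeparablyMeasurable μ f)
    (hv : IntegrallyWeakStarMeasurable μ v) (hB : MeasurableSet B) [SigmaFinite (μ.restrict B)] :
    ∃ W : Set X, IsSeparable W ∧ ∀ W' : Set X, IsSeparable W' →
      ∀ᵐ ω ∂μ.restrict B, conjugateOn (f ω) W' (v ω) ≤ conjugateOn (f ω) W (v ω) := by
  let ν := (μ.restrict B).toFinite
  let J : Set X → ℝ≥0∞ := fun W => ∫⁻ ω, logistic (conjugateOn (f ω) W (v ω)) ∂ν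
  have hJ : Monotone J := fun _ _ h =>
    lintegral_mono fun _ => logistic_strictMono.monotone (conjugateOn_mono _ h _)
  have hJfin (W : Set X) : J W ≠ ∞ :=
    ne_top_of_le_ne_top (measure_ne_top ν Set.univ) <|
      (lintegral_mono fun _ => logistic_le_one _).trans_eq lintegral_one
  have : Nonempty {W : Set X // IsClosed W ∧ IsSeparable W} :=
    ⟨⟨∅, isClosed_empty, Set.countable_empty.isSeparable⟩⟩
  obtain ⟨⟨W, hWc, hW⟩, hmax⟩ := exists_forall_le_of_forall_seq
    (fun W : {W : Set X // IsClosed W ∧ IsSeparable W} => J W) fun W =>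
      ⟨⟨closure (⋃ n, W n), isClosed_closure, (IsSeparable.iUnion fun n => (W n).2.2).closure⟩,
        fun n => hJ ((Set.subset_iUnion (fun n => (W n : Set X)) n).trans subset_closure)⟩
  refine ⟨W, hW, fun W' hW' => ?_⟩
  have hU : IsSeparable (closure (W ∪ W')) := (hW.union hW').closure
  have heq := ae_eq_of_ae_le_of_lintegral_le
    (ae_of_all ν fun ω => logistic_strictMono.monotone
      (conjugateOn_mono (f ω) (Set.subset_union_left.trans subset_closure) (v ω)))
    (hJfin W)
    (measurable_logistic.comp_aemeasurable <|
      (aemeasurable_conjugateOn hf hv hB isClosed_closure hU).mono_ac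
        (toFinite_absolutelyContinuous _))
    (hmax ⟨closure (W ∪ W'), isClosed_closure, hU⟩)
  filter_upwards [absolutelyContinuous_toFinite (μ.restrict B) heq] with ω hω
  rw [logistic_strictMono.injective hω]
  exact conjugateOn_mono _ (Set.subset_union_right.trans subset_closure) _

end SigmaFinite

lemma IsEssSupOn.ae_eq {ι : Type*} {φ : ι → Ω → EReal} {m n : Ω → EReal}
    (hm : IsEssSupOn μ A φ m) (hn : IsEssSupOn μ A φ n) : m =ᵐ[μ.restrict A] n := by
  filter_upwards [hm.2.2 n hn.1 hn.2.1, hn.2.2 m hm.1 hm.2.1] with ω hmn hnm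
  exact le_antisymm hmn hnm

lemma IsEssSupOn.mono_set {ι : Type*} {φ : ι → Ω → EReal} {m : Ω → EReal}
    (hm : IsEssSupOn μ B φ m) (hA : MeasurableSet A) (hAB : A ⊆ B) : IsEssSupOn μ A φ m := by
  classical
  have hle (i : ι) := ae_restrict_of_ae_restrict_of_subset hAB (hm.2.1 i)
  refine ⟨hm.1.mono_set hAB, hle, fun n hn hφn => ?_⟩
  have hnA : A.piecewise n m =ᵐ[μ.restrict A] n := piecewise_ae_eq_restrict hA
  have hmA : A.piecewise n m =ᵐ[μ.restrict (B \ A)] m :=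
    ae_restrict_of_ae_restrict_of_subset (fun _ hω => hω.2) (piecewise_ae_eq_restrict_compl hA)
  have hBA : A ∪ B \ A = B := Set.union_sdiff_cancel hAB
  have hmax : ∀ᵐ ω ∂μ.restrict B, m ω ≤ A.piecewise n m ω := by
    refine hm.2.2 _ ?_ fun i => ?_
    · rw [← hBA, aemeasurable_union_iff]
      exact ⟨hn.congr hnA.symm, (hm.1.mono_set Set.sdiff_subset).congr hmA.symm⟩
    · rw [← hBA, ae_restrict_union_iff]
      constructor
      · filter_upwards [hφn i, hnA] with ω hω hωn using hωn ▸ hω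
      · filter_upwards [ae_restrict_of_ae_restrict_of_subset Set.sdiff_subset (hm.2.1 i), hmA]
          with ω hω hωm using hωm ▸ hω
  filter_upwards [ae_restrict_of_ae_restrict_of_subset hAB hmax, hnA] with ω hω hωn
  exact hωn ▸ hω

lemma isConsistent_of_isEssSupOn {ι : Type*} {φ : ι → Ω → EReal} {m : Set Ω → Ω → EReal}
    (hm : ∀ A ∈ atomSigma μ, IsEssSupOn μ A φ (m A)) : IsConsistent μ m :=
  fun A hA B hB hAB =>
    (hm A hA).ae_eq ((hm B hB).mono_set (measurableSet_of_mem_atomSigma hA) hAB)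

/-- `m` is an essential supremum on `A` of the functions `ω ↦ sup_{x ∈ W} ⟨v(ω), x⟩ - f(ω, x)`
over all separable sets `W`. -/
abbrev IsEssSupConjugateOn (μ : Measure Ω) (f : Ω → X → EReal) (v : Ω → X →L[ℝ] ℝ) (A : Set Ω)
    (m : Ω → EReal) : Prop :=
  IsEssSupOn μ A (fun (W : {W : Set X // IsSeparable W}) ω => conjugateOn (f ω) W (v ω)) m

/-- `W` is a closed separable set for which `ω ↦ sup_{x ∈ W} ⟨v(ω), x⟩ - f(ω, x)` is largest
a.e. on `A`, so that this function is the essential supremum of `IsEssSupConjugateOn`. -/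
structure IsEssMaximalOn (μ : Measure Ω) (f : Ω → X → EReal) (v : Ω → X →L[ℝ] ℝ) (A : Set Ω)
    (W : Set X) : Prop where
  isClosed : IsClosed W
  isSeparable : IsSeparable W
  aemeasurable : AEMeasurable (fun ω => conjugateOn (f ω) W (v ω)) (μ.restrict A)
  ae_le : ∀ W' : Set X, IsSeparable W' →
    ∀ᵐ ω ∂μ.restrict A, conjugateOn (f ω) W' (v ω) ≤ conjugateOn (f ω) W (v ω)

lemma IsEssMaximalOn.isEssSupConjugateOn (hW : IsEssMaximalOn μ f v A W) :
    IsEssSupConjugateOn μ f v A fun ω => conjugateOn (f ω) W (v ω) :=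
  ⟨hW.aemeasurable, fun W' => hW.ae_le W' W'.2, fun _ _ hn => hn ⟨W, hW.isSeparable⟩⟩

/-- The condition on `v` on the atoms of infinite measure. -/
def NonposOnInfiniteAtoms (μ : Measure Ω) (f : Ω → X → EReal) (v : Ω → X →L[ℝ] ℝ) : Prop :=
  ∀ A : Set Ω, IsMeasureAtom μ A → μ A = ∞ → ∀ W : Set X, IsSeparable W →
    ∀ᵐ ω ∂μ.restrict A, conjugateOn (f ω) W (v ω) ≤ 0

lemma NonposOnInfiniteAtoms.ae_conjugateOn_nonpos (hneg : NonposOnInfiniteAtoms μ f v)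
    (hDμ : IsZeroOrTopOn μ D) (hD : MeasurableSet D) (hW : IsSeparable W) :
    ∀ᵐ ω ∂μ.restrict D, conjugateOn (f ω) W (v ω) ≤ 0 := by
  rcases hDμ.measure_eq_zero_or_isMeasureAtom hD with h₀ | ⟨hatom, htop⟩
  · rw [Measure.restrict_eq_zero.2 h₀, ae_zero]
    exact Filter.eventually_bot
  · exact hneg D hatom htop W hW

/-- `u` and `v` are integrally strongly and weak* measurable, and `⟨u, v⟩` is finite. -/
structure IsPaired (μ : Measure Ω) (u : Ω → X) (v : Ω → X →L[ℝ] ℝ) : Prop where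
  stronglyMeasurable : IntegrallyStronglyMeasurable μ u
  weakStarMeasurable : IntegrallyWeakStarMeasurable μ v
  pairing_ne_top : pairing μ u v ≠ ⊤
  pairing_ne_bot : pairing μ u v ≠ ⊥

variable [MeasurableSpace X] [BorelSpace X]

lemma IsPaired.integrable_apply (h : IsPaired μ u v) (hA : A ∈ atomSigma μ) :
    Integrable (fun ω => v ω (u ω)) (μ.restrict A) := by
  obtain ⟨p, hp, hpe⟩ := exists_integrable_of_extIntegral_finite
    (aemeasurable_apply h.weakStarMeasurable h.stronglyMeasurable hA).coe_real_ereal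
    (extIntegral_restrict_ne_top h.pairing_ne_top hA)
    (extIntegral_restrict_ne_bot h.pairing_ne_top h.pairing_ne_bot hA)
  exact hp.congr (hpe.mono fun ω hω => (EReal.coe_eq_coe_iff.1 hω).symm)

lemma IsPaired.ae_nonneg_conjugateIntegrand (h : IsPaired μ u v)
    (hf : IntegrallySeparablyMeasurable μ f) (hI : integralFunctional μ f u ≠ ⊤)
    (hDμ : IsZeroOrTopOn μ D) (hD : MeasurableSet D) :
    ∀ᵐ ω ∂μ.restrict D, 0 ≤ conjugateIntegrand f v u ω := by
  have hDa := hDμ.mem_atomSigma hD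
  have hvint := h.integrable_apply hDa
  have hfint := mt extIntegral_eq_top_iff.2 (extIntegral_restrict_ne_top hI hDa)
  filter_upwards [
    hDμ.ae_eq_zero_of_lintegral_ne_top hD hvint.1.aemeasurable.enorm hvint.2.ne,
    hDμ.ae_eq_zero_of_lintegral_ne_top hD
      (aemeasurable_integrand hf h.stronglyMeasurable hDa).ereal_toENNReal hfint] with ω hvω hfω
  rw [conjugateIntegrand, enorm_eq_zero.1 hvω, EReal.coe_zero,
    EReal.sub_nonneg (by simp) (by simp)]
  exact EReal.toENNReal_eq_zero_iff.1 hfω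

variable [CompleteSpace X]

/-- The essential supremum vanishes on the atoms of infinite measure, where it is attained by the
range of any `u` with `I_f(u) < ∞`. -/
lemma IsPaired.exists_isEssMaximalOn (h : IsPaired μ u v)
    (hf : IntegrallySeparablyMeasurable μ f) (hI : integralFunctional μ f u ≠ ⊤)
    (hneg : NonposOnInfiniteAtoms μ f v) (hA : A ∈ atomSigma μ) :
    ∃ W : Set X, IsEssMaximalOn μ f v A W := by
  have huA := h.stronglyMeasurable.isSeparable_image hA
  obtain ⟨D, B, rfl, -, hD, hDμ, hB, hfin⟩ := exists_decomposition_of_mem_atomSigma hA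
  obtain ⟨W₀, hW₀, hmax⟩ :=
    exists_forall_conjugateOn_le_of_sigmaFinite hf h.weakStarMeasurable hB
  have hW : IsSeparable (closure (W₀ ∪ u '' (D ∪ B))) := (hW₀.union huA).closure
  have hDzero : ∀ᵐ ω ∂μ.restrict D,
      conjugateOn (f ω) (closure (W₀ ∪ u '' (D ∪ B))) (v ω) = 0 := by
    filter_upwards [hneg.ae_conjugateOn_nonpos hDμ hD hW,
      h.ae_nonneg_conjugateIntegrand hf hI hDμ hD, ae_restrict_mem hD] with ω hle hge hωD
    have huW : u ω ∈ closure (W₀ ∪ u '' (D ∪ B)) :=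
      subset_closure (Or.inr (Set.mem_image_of_mem u (Set.mem_union_left B hωD)))
    exact le_antisymm hle (hge.trans (le_conjugateOn _ huW _))
  refine ⟨_, isClosed_closure, hW, aemeasurable_union_iff.2 ⟨?_, ?_⟩, fun W' hW' =>
    ae_restrict_union_iff _ _ _ |>.2 ⟨?_, ?_⟩⟩
  · exact aemeasurable_const.congr (Filter.EventuallyEq.symm hDzero)
  · exact aemeasurable_conjugateOn hf h.weakStarMeasurable hB isClosed_closure hW
  · filter_upwards [hneg.ae_conjugateOn_nonpos hDμ hD hW', hDzero] with ω hle hzero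
    exact hle.trans_eq hzero.symm
  · filter_upwards [hmax W' hW'] with ω hω
    exact hω.trans (conjugateOn_mono _ (Set.subset_union_left.trans subset_closure) _)

end EssentialMaximum

/-! ### Almost maximizers in an almost decomposable space -/

section AlmostMaximizers

variable {Ω : Type*} [MeasurableSpace Ω] {μ : Measure Ω} {B : Set Ω} {L : ℝ≥0∞}

lemma exists_simpleFunc_lt_of_lt_lintegral {ν : Measure Ω} [SigmaFinite ν] {q : Ω → ℝ≥0∞}
    (hL : L < ∫⁻ ω, q ω ∂ν) :
    ∃ s : SimpleFunc Ω NNReal, (∀ ω, s ω ≠ 0 → (s ω : ℝ≥0∞) < q ω) ∧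
      ∫⁻ ω, s ω ∂ν ≠ ∞ ∧ L < ∫⁻ ω, s ω ∂ν := by
  simp_rw [lintegral_eq_nnreal, lt_iSup_iff, ← SimpleFunc.lintegral_eq_lintegral] at hL
  obtain ⟨r, hrq, hLr⟩ := hL
  obtain ⟨s, hsr, hsfin, hLs⟩ :=
    SimpleFunc.exists_lt_lintegral_simpleFunc_of_lt_lintegral (by simpa using hLr)
  have hs₀ : ∫⁻ ω, s ω ∂ν ≠ 0 := (bot_le.trans_lt hLs).ne'
  have hdiv : L / ∫⁻ ω, s ω ∂ν < 1 := by
    rwa [ENNReal.div_lt_iff (Or.inl hs₀) (Or.inl hsfin.ne), one_mul]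
  obtain ⟨t, hLt, ht⟩ := ENNReal.lt_iff_exists_nnreal_btwn.1 hdiv
  rw [ENNReal.div_lt_iff (Or.inl hs₀) (Or.inl hsfin.ne)] at hLt
  have hint : ∫⁻ ω, (s.map (t * ·) ω : NNReal) ∂ν = t * ∫⁻ ω, s ω ∂ν := by
    simp only [SimpleFunc.map_apply, ENNReal.coe_mul]
    exact lintegral_const_mul _ s.measurable.coe_nnreal_ennreal
  refine ⟨s.map (t * ·), fun ω hω => ?_, hint ▸ ENNReal.mul_ne_top ENNReal.coe_ne_top hsfin.ne,
    hint ▸ hLt⟩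
  have hsω : 0 < s ω := pos_iff_ne_zero.2 (right_ne_zero_of_mul hω)
  calc ((t * s ω : NNReal) : ℝ≥0∞) < s ω :=
        ENNReal.coe_lt_coe.2 (mul_lt_of_lt_one_left hsω (by exact_mod_cast ht))
    _ ≤ r ω := ENNReal.coe_le_coe.2 (hsr ω)
    _ ≤ q ω := hrq ω

section Decomposable

variable {E : Type*} [NormedAddCommGroup E] {w u : Ω → E} {s : Ω → ℝ≥0∞}

lemma exists_subset_bounded_lt_setLIntegral (hB : MeasurableSet B) [SigmaFinite (μ.restrict B)]
    (hw : StronglyMeasurable w) (hL : L < ∫⁻ ω in B, s ω ∂μ) :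
    ∃ F ⊆ B, MeasurableSet F ∧ μ F < ∞ ∧ (∃ C : ℝ, ∀ ω ∈ F, ‖w ω‖ ≤ C) ∧
      L < ∫⁻ ω in F, s ω ∂μ := by
  let F (n : ℕ) : Set Ω := spanningSets (μ.restrict B) n ∩ {ω | ‖w ω‖ ≤ n} ∩ B
  have hF : Monotone F := fun m n hmn ω hω =>
    ⟨⟨spanningSets_mono hmn hω.1.1, le_trans (α := ℝ) hω.1.2 (Nat.cast_le.2 hmn)⟩, hω.2⟩
  have hFB : ⋃ n, F n = B := by
    refine (Set.iUnion_subset fun n => Set.inter_subset_right).antisymm fun ω hω => ?_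
    obtain ⟨n, hn⟩ := exists_nat_ge ‖w ω‖
    obtain ⟨k, hk⟩ := Set.mem_iUnion.1
      ((iUnion_spanningSets (μ.restrict B)).symm ▸ Set.mem_univ ω)
    exact Set.mem_iUnion.2 ⟨max n k, ⟨spanningSets_mono (le_max_right n k) hk,
      hn.trans (Nat.cast_le.2 (le_max_left n k))⟩, hω⟩
  rw [← hFB, setLIntegral_iUnion_of_directed _ hF.directed_le, lt_iSup_iff] at hL
  obtain ⟨n, hn⟩ := hL
  refine ⟨F n, Set.inter_subset_right, ((measurableSet_spanningSets _ n).inter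
    (measurableSet_le hw.norm.measurable measurable_const)).inter hB, ?_,
    ⟨n, fun ω hω => hω.1.2⟩, hn⟩
  refine (measure_mono ?_).trans_lt ((Measure.restrict_apply' hB).symm.trans_lt
    (measure_spanningSets_lt_top (μ.restrict B) n))
  exact Set.inter_subset_inter_left B Set.inter_subset_left

open Classical in
lemma AlmostDecomposable.exists_piecewise_mem {R : Set (Ω → E)} (hR : AlmostDecomposable μ R)
    (hu : u ∈ R) (hB : MeasurableSet B) [SigmaFinite (μ.restrict B)] (hw : StronglyMeasurable w)
    (hs : ∫⁻ ω in B, s ω ∂μ ≠ ∞) (hL : L < ∫⁻ ω in B, s ω ∂μ) :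
    ∃ G ⊆ B, MeasurableSet G ∧ G.piecewise w u ∈ R ∧ L < ∫⁻ ω in G, s ω ∂μ := by
  obtain ⟨F, hFB, hF, hμF, ⟨C, hC⟩, hLF⟩ := exists_subset_bounded_lt_setLIntegral hB hw hL
  have hsF : ∫⁻ ω in F, s ω ∂μ ≠ ∞ := ne_top_of_le_ne_top hs (lintegral_mono_set hFB)
  obtain ⟨δ, hδ, hsmall⟩ := exists_pos_setLIntegral_lt_of_measure_lt hsF (tsub_pos_of_lt hLF).ne'
  have hbdd : ∀ ω, ‖F.indicator w ω‖ ≤ max C 0 := fun ω => by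
    by_cases hω : ω ∈ F
    · exact (Set.indicator_of_mem hω w).symm ▸ (hC ω hω).trans (le_max_left C 0)
    · simp [Set.indicator_of_notMem hω]
  obtain ⟨G, hGF, hG, hFG, hGR⟩ :=
    hR u hu F hF hμF δ hδ (F.indicator w) (hw.indicator hF) ⟨_, hbdd⟩
  have hpiece : G.piecewise (F.indicator w) u = G.piecewise w u := by
    funext ω
    by_cases hω : ω ∈ G
    · simp only [Set.piecewise_eq_of_mem _ _ _ hω, Set.indicator_of_mem (hGF hω)]
    · simp only [Set.piecewise_eq_of_notMem _ _ _ hω]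
  refine ⟨G, hGF.trans hFB, hG, hpiece ▸ hGR, ?_⟩
  have hloss : ∫⁻ ω in F \ G, s ω ∂μ < ∫⁻ ω in F, s ω ∂μ - L := by
    simpa only [Measure.restrict_restrict (hF.diff hG),
      Set.inter_eq_self_of_subset_left Set.sdiff_subset] using
      hsmall (F \ G) ((Measure.restrict_apply_le _ _).trans_lt hFG)
  have hsplit := lintegral_inter_add_sdiff s F hG (μ := μ)
  rw [Set.inter_eq_self_of_subset_right hGF] at hsplit
  by_contra! hGL
  refine (ENNReal.add_lt_add_of_le_of_lt (ne_top_of_le_ne_top hLF.ne_top hGL) hGL hloss).ne ?_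
  rw [hsplit, add_tsub_cancel_of_le hLF.le]

end Decomposable

variable {X : Type*} [NormedAddCommGroup X] [NormedSpace ℝ X] [CompleteSpace X]
  [MeasurableSpace X] [BorelSpace X] {f : Ω → X → EReal} {v : Ω → X →L[ℝ] ℝ} {W : Set X}

lemma exists_add_le_conjugateIntegrand (hf : IntegrallySeparablyMeasurable μ f)
    (hv : IntegrallyWeakStarMeasurable μ v) (hB : MeasurableSet B) [SigmaFinite (μ.restrict B)]
    (hWc : IsClosed W) (hW : IsSeparable W) {g : Ω → ℝ} (hg : Measurable g)
    (hL : L < ∫⁻ ω in B, (conjugateOn (f ω) W (v ω) - g ω).toENNReal ∂μ) :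
    ∃ B' ⊆ B, MeasurableSet B' ∧ ∃ (w : Ω → X) (s : Ω → NNReal), StronglyMeasurable w ∧
      Measurable s ∧ ∫⁻ ω in B', s ω ∂μ ≠ ∞ ∧ L < ∫⁻ ω in B', s ω ∂μ ∧
      ∀ᵐ ω ∂μ.restrict B', ((g ω + s ω : ℝ) : EReal) ≤ conjugateIntegrand f v w ω := by
  obtain ⟨s, hsq, hsfin, hLs⟩ := exists_simpleFunc_lt_of_lt_lintegral hL
  obtain ⟨w, hw, hlt⟩ := exists_stronglyMeasurable_lt_conjugateIntegrand hf hv hB hWc hW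
    (hg.add s.measurable.coe_nnreal_real).coe_real_ereal
  have hsupp : MeasurableSet {ω | s ω ≠ 0} := s.measurable (measurableSet_singleton 0).compl
  have hint : ∫⁻ ω in {ω | s ω ≠ 0} ∩ B, s ω ∂μ = ∫⁻ ω in B, s ω ∂μ := by
    rw [← Measure.restrict_restrict hsupp]
    exact setLIntegral_eq_of_support_subset fun ω hω => ENNReal.coe_ne_zero.1 hω
  refine ⟨{ω | s ω ≠ 0} ∩ B, Set.inter_subset_right, hsupp.inter hB, w, s, hw, s.measurable,
    hint ▸ hsfin, hint ▸ hLs, ?_⟩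
  filter_upwards [ae_restrict_of_ae_restrict_of_subset Set.inter_subset_right hlt,
    ae_restrict_mem (hsupp.inter hB)] with ω hω hωs
  refine (hω ?_).le
  have hpos := (hsq ω hωs.1).bot_lt
  have hsub : ((s ω : ℝ) : EReal) < conjugateOn (f ω) W (v ω) - g ω := by
    rw [← EReal.coe_toENNReal (EReal.toENNReal_pos_iff.1 hpos).le]
    exact EReal.coe_ennreal_lt_coe_ennreal_iff.2 (hsq ω hωs.1)
  rw [Pi.add_apply, add_comm]
  exact EReal.add_lt_of_lt_sub hsub

end AlmostMaximizers

/-! ### The conjugate functional -/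

section ConjugateFunctional

lemma coe_add_coe_ennreal_le {a : ℝ} {c : EReal} {l : ℝ≥0∞} (hac : (a : EReal) ≤ c)
    (h : ∀ L < l, (a : EReal) + (L : ℝ≥0∞) ≤ c) : (a : EReal) + l ≤ c := by
  have hsub (L : ℝ≥0∞) : (a : EReal) + L ≤ c ↔ L ≤ (c - a).toENNReal := by
    rw [← EReal.coe_ennreal_le_coe_ennreal_iff,
      EReal.coe_toENNReal ((EReal.sub_nonneg (by simp) (by simp)).2 hac),
      EReal.le_sub_iff_add_le (by simp) (by simp), add_comm]
  exact (hsub l).2 (le_of_forall_lt_imp_le_of_dense fun L hL => (hsub L).1 (h L hL))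

variable {Ω : Type*} [MeasurableSpace Ω] {μ : Measure Ω}

lemma extIntegral_le_add_lintegral_sub {ν : Measure Ω} {g : Ω → ℝ} {h : Ω → EReal}
    (hg : Integrable g ν) (hh : AEMeasurable h ν) :
    extIntegral ν h ≤ ((∫ ω, g ω ∂ν : ℝ) : EReal) + ∫⁻ ω, (h ω - g ω).toENNReal ∂ν := by
  have hsub : AEMeasurable (fun ω => h ω - g ω) ν :=
    hh.sub hg.aestronglyMeasurable.aemeasurable.coe_real_ereal
  rw [← extIntegral_coe_ennreal,
    ← extIntegral_coe_add hg hsub.ereal_toENNReal.coe_ereal_ennreal]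
  refine extIntegral_mono (ae_of_all _ fun ω => ?_)
  beta_reduce
  rw [add_comm, ← EReal.sub_le_iff_le_add (by simp) (by simp)]
  exact (le_max_right 0 _).trans_eq EReal.coe_toENNReal_eq_max.symm

variable {X : Type*} [NormedAddCommGroup X] [NormedSpace ℝ X] {f : Ω → X → EReal} {u w : Ω → X}
  {v : Ω → X →L[ℝ] ℝ} {A B D : Set Ω} {W : Set X} {R : Submodule ℝ (Ω → X)}

lemma le_conjugateFunctional (hu : u ∈ R) :
    pairing μ u v - integralFunctional μ f u ≤ conjugateFunctional μ f R v :=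
  le_iSup₂ (f := fun u (_ : u ∈ R) => pairing μ u v - integralFunctional μ f u) u hu

lemma conjugateFunctional_eq_top (hu : u ∈ R) (hp : pairing μ u v ≠ ⊥)
    (hI : integralFunctional μ f u = ⊥) : conjugateFunctional μ f R v = ⊤ := by
  refine top_le_iff.1 (le_trans ?_ (le_conjugateFunctional hu))
  rw [hI, EReal.sub_bot hp]

lemma ae_conjugateIntegrand_le {m : Ω → EReal} (hu : IntegrallyStronglyMeasurable μ u)
    (hA : A ∈ atomSigma μ) (hm : IsEssSupConjugateOn μ f v A m) :
    ∀ᵐ ω ∂μ.restrict A, conjugateIntegrand f v u ω ≤ m ω := by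
  filter_upwards [hm.2.1 ⟨_, hu.isSeparable_image hA⟩,
    ae_restrict_mem (measurableSet_of_mem_atomSigma hA)] with ω hω hωA
  exact (le_conjugateOn _ (Set.mem_image_of_mem u hωA) _).trans hω

variable [MeasurableSpace X] [BorelSpace X]

lemma IsPaired.eventually_pairing_eq (h : IsPaired μ u v) :
    ∀ᶠ A : atomSigma μ in Filter.atTop,
      pairing μ u v = ((∫ ω in A, v ω (u ω) ∂μ : ℝ) : EReal) := by
  filter_upwards [eventually_exhIntegral_eq fun ω => ((v ω (u ω) : ℝ) : EReal)] with A hA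
  rw [pairing, hA, extIntegral_coe (h.integrable_apply A.2)]

lemma IsPaired.pairing_sub_integralFunctional (h : IsPaired μ u v)
    (hf : IntegrallySeparablyMeasurable μ f) (hI : integralFunctional μ f u ≠ ⊤) :
    pairing μ u v - integralFunctional μ f u = exhIntegral μ (conjugateIntegrand f v u) := by
  obtain ⟨A, hAp, hAf, hAc⟩ := (h.eventually_pairing_eq.and ((eventually_exhIntegral_eq
    fun ω => f ω (u ω)).and (eventually_exhIntegral_eq (conjugateIntegrand f v u)))).exists
  have hfu := aemeasurable_integrand hf h.stronglyMeasurable A.2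
  calc pairing μ u v - integralFunctional μ f u
      = ((∫ ω in A, v ω (u ω) ∂μ : ℝ) : EReal)
          + extIntegral (μ.restrict A) fun ω => -f ω (u ω) := by
        rw [extIntegral_neg (extIntegral_restrict_ne_top hI A.2), ← hAf, hAp]
        rfl
    _ = extIntegral (μ.restrict A) (conjugateIntegrand f v u) :=
        (extIntegral_coe_add (h.integrable_apply A.2) hfu.neg).symm
    _ = exhIntegral μ (conjugateIntegrand f v u) := hAc.symm

lemma IsPaired.exhIntegral_conjugateIntegrand_finite (h : IsPaired μ u v)
    (hf : IntegrallySeparablyMeasurable μ f) (hI : integralFunctional μ f u ≠ ⊤)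
    (hI' : integralFunctional μ f u ≠ ⊥) :
    exhIntegral μ (conjugateIntegrand f v u) ≠ ⊤ ∧
      exhIntegral μ (conjugateIntegrand f v u) ≠ ⊥ := by
  rw [← h.pairing_sub_integralFunctional hf hI, ← EReal.coe_toReal hI hI',
    ← EReal.coe_toReal h.pairing_ne_top h.pairing_ne_bot, ← EReal.coe_sub]
  exact ⟨EReal.coe_ne_top _, EReal.coe_ne_bot _⟩

lemma IsPaired.integralFunctional_ne_top_of_le {φ : Ω → EReal} (h : IsPaired μ w v)
    (hφ : ∀ A ∈ atomSigma μ, AEMeasurable φ (μ.restrict A)) (ht : exhIntegral μ φ ≠ ⊤)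
    (hb : exhIntegral μ φ ≠ ⊥) (hle : IAE μ fun ω => φ ω ≤ conjugateIntegrand f v w ω) :
    integralFunctional μ f w ≠ ⊤ := by
  obtain ⟨A, hA⟩ := (eventually_exhIntegral_eq fun ω => f ω (w ω)).exists
  obtain ⟨q, hq, hφq⟩ := exists_integrable_of_extIntegral_finite (hφ A A.2)
    (extIntegral_restrict_ne_top ht A.2) (extIntegral_restrict_ne_bot ht hb A.2)
  have hfw : ∀ᵐ ω ∂μ.restrict A, f ω (w ω) ≤ ((v ω (w ω) - q ω : ℝ) : EReal) := by
    filter_upwards [hφq, hle A A.2] with ω hω hωle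
    rw [hω, conjugateIntegrand, EReal.le_sub_iff_add_le (by simp) (by simp), add_comm] at hωle
    rw [EReal.coe_sub, EReal.le_sub_iff_add_le (by simp) (by simp)]
    exact hωle
  rw [integralFunctional, hA]
  refine ne_top_of_le_ne_top ?_ (extIntegral_mono hfw)
  exact (extIntegral_coe ((h.integrable_apply A.2).sub hq)).trans_ne (EReal.coe_ne_top _)

lemma IsPaired.setLIntegral_union_sub_eq {g : Ω → ℝ} (h : IsPaired μ u v)
    (hf : IntegrallySeparablyMeasurable μ f) (hI : integralFunctional μ f u ≠ ⊤)
    (hneg : NonposOnInfiniteAtoms μ f v) (hDμ : IsZeroOrTopOn μ D) (hD : MeasurableSet D)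
    (hB : MeasurableSet B) (hDB : Disjoint D B) (hW : IsSeparable W)
    (hgu : ∀ᵐ ω ∂μ.restrict D, conjugateIntegrand f v u ω = g ω) :
    ∫⁻ ω in D ∪ B, (conjugateOn (f ω) W (v ω) - g ω).toENNReal ∂μ =
      ∫⁻ ω in B, (conjugateOn (f ω) W (v ω) - g ω).toENNReal ∂μ := by
  have hzero : ∀ᵐ ω ∂μ.restrict D, (conjugateOn (f ω) W (v ω) - g ω).toENNReal = 0 := by
    filter_upwards [hneg.ae_conjugateOn_nonpos hDμ hD hW,
      h.ae_nonneg_conjugateIntegrand hf hI hDμ hD, hgu] with ω hle hge hω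
    exact EReal.toENNReal_of_nonpos (EReal.sub_nonpos.2 (hle.trans (hω ▸ hge)))
  rw [lintegral_union hB hDB, lintegral_congr_ae hzero, lintegral_zero, zero_add]

/-- The standing assumptions on the space `R`, the integrand `f` and the functional `v`. -/
structure Admissible (μ : Measure Ω) (R : Submodule ℝ (Ω → X)) (f : Ω → X → EReal)
    (v : Ω → X →L[ℝ] ℝ) : Prop where
  almostDecomposable : AlmostDecomposable μ (R : Set (Ω → X))
  paired : ∀ u ∈ R, IsPaired μ u v
  separablyMeasurable : IntegrallySeparablyMeasurable μ f
  exists_ne_top : ∃ u ∈ R, integralFunctional μ f u ≠ ⊤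
  nonposOnInfiniteAtoms : NonposOnInfiniteAtoms μ f v

lemma Admissible.conjugateFunctional_le {m : Set Ω → Ω → EReal} (h : Admissible μ R f v)
    (hm : ∀ A ∈ atomSigma μ, IsEssSupConjugateOn μ f v A (m A)) :
    conjugateFunctional μ f R v ≤ exhIntegralFam μ m := by
  refine iSup₂_le fun u hu => ?_
  by_cases hI : integralFunctional μ f u = ⊤
  · rw [hI, EReal.sub_top]
    exact bot_le
  · rw [(h.paired u hu).pairing_sub_integralFunctional h.separablyMeasurable hI]
    exact exhIntegralFam_mono fun A hA =>
      ae_conjugateIntegrand_le (h.paired u hu).stronglyMeasurable hA (hm A hA)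

variable [CompleteSpace X]

open Classical in
lemma exists_mem_exhIntegral_add_le {R : Set (Ω → X)} {g : Ω → ℝ} {L : ℝ≥0∞}
    (hR : AlmostDecomposable μ R) (hf : IntegrallySeparablyMeasurable μ f)
    (hv : IntegrallyWeakStarMeasurable μ v) (hu : u ∈ R) (hum : IntegrallyStronglyMeasurable μ u)
    (ht : exhIntegral μ (conjugateIntegrand f v u) ≠ ⊤)
    (hb : exhIntegral μ (conjugateIntegrand f v u) ≠ ⊥) (hB : MeasurableSet B)
    [SigmaFinite (μ.restrict B)] (hWc : IsClosed W) (hW : IsSeparable W) (hg : Measurable g)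
    (hgu : ∀ᵐ ω ∂μ.restrict B, conjugateIntegrand f v u ω = g ω)
    (hL : L < ∫⁻ ω in B, (conjugateOn (f ω) W (v ω) - g ω).toENNReal ∂μ) :
    ∃ w ∈ R, (IAE μ fun ω => conjugateIntegrand f v u ω ≤ conjugateIntegrand f v w ω) ∧
      exhIntegral μ (conjugateIntegrand f v u) + L ≤
        exhIntegral μ (conjugateIntegrand f v w) := by
  obtain ⟨F, hFB, hF, w, s, hw, hs, hsF, hLF, hsw⟩ :=
    exists_add_le_conjugateIntegrand hf hv hB hWc hW hg hL
  have : SigmaFinite (μ.restrict F) :=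
    Measure.sigmaFinite_of_le _ (Measure.restrict_mono hFB le_rfl)
  obtain ⟨G, hGF, hG, hGR, hLG⟩ := hR.exists_piecewise_mem hu hF hw hsF hLF
  have hgain : ∀ᵐ ω ∂μ, conjugateIntegrand f v u ω + (G.indicator (fun ω => (s ω : ℝ≥0∞)) ω) ≤
      conjugateIntegrand f v (G.piecewise w u) ω := by
    rw [ae_restrict_iff' hB] at hgu
    rw [ae_restrict_iff' hF] at hsw
    filter_upwards [hgu, hsw] with ω hgω hsω
    by_cases hω : ω ∈ G
    · rw [conjugateIntegrand.eq_def _ _ (G.piecewise w u), Set.piecewise_eq_of_mem _ _ _ hω,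
        Set.indicator_of_mem hω, hgω (hFB (hGF hω))]
      exact hsω (hGF hω)
    · rw [conjugateIntegrand.eq_def _ _ (G.piecewise w u), Set.piecewise_eq_of_notMem _ _ _ hω,
        Set.indicator_of_notMem hω, EReal.coe_ennreal_zero, add_zero]
      rfl
  refine ⟨G.piecewise w u, hGR, fun A _ => ?_, ?_⟩
  · filter_upwards [ae_restrict_of_ae hgain] with ω hω
    exact (le_add_of_nonneg_right (EReal.coe_ennreal_nonneg _)).trans hω
  · have : SigmaFinite (μ.restrict G) :=
      Measure.sigmaFinite_of_le _ (Measure.restrict_mono hGF le_rfl)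
    refine le_trans ?_ (exhIntegral_add_setLIntegral_le
      (fun A hA => aemeasurable_conjugateIntegrand hf hv hum hA) hs.coe_nnreal_ennreal ht hb
      (mem_atomSigma_of_sigmaFinite hG this) fun A _ => ae_restrict_of_ae hgain)
    exact add_le_add le_rfl (EReal.coe_ennreal_le_coe_ennreal_iff.2 hLG.le)

namespace Admissible

lemma exists_isEssMaximalOn (h : Admissible μ R f v) (hA : A ∈ atomSigma μ) :
    ∃ W : Set X, IsEssMaximalOn μ f v A W := by
  obtain ⟨u, hu, hI⟩ := h.exists_ne_top
  exact (h.paired u hu).exists_isEssMaximalOn h.separablyMeasurable hI h.nonposOnInfiniteAtoms hA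

lemma exhIntegral_add_lintegral_le_conjugateFunctional {g : Ω → ℝ} (h : Admissible μ R f v)
    (hu : u ∈ R) (hI : integralFunctional μ f u ≠ ⊤) (hI' : integralFunctional μ f u ≠ ⊥)
    (hB : MeasurableSet B) [SigmaFinite (μ.restrict B)] (hWc : IsClosed W) (hW : IsSeparable W)
    (hg : Measurable g) (hgu : ∀ᵐ ω ∂μ.restrict B, conjugateIntegrand f v u ω = g ω) :
    exhIntegral μ (conjugateIntegrand f v u) +
        (∫⁻ ω in B, (conjugateOn (f ω) W (v ω) - g ω).toENNReal ∂μ : ℝ≥0∞) ≤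
      conjugateFunctional μ f R v := by
  have hf := h.separablyMeasurable
  have hp := h.paired u hu
  obtain ⟨ht, hb⟩ := hp.exhIntegral_conjugateIntegrand_finite hf hI hI'
  have hle : exhIntegral μ (conjugateIntegrand f v u) ≤ conjugateFunctional μ f R v :=
    (hp.pairing_sub_integralFunctional hf hI).ge.trans (le_conjugateFunctional hu)
  rw [← EReal.coe_toReal ht hb] at hle ⊢
  refine coe_add_coe_ennreal_le hle fun L hL => ?_
  rw [EReal.coe_toReal ht hb]
  obtain ⟨w, hw, hφw, hLw⟩ := exists_mem_exhIntegral_add_le h.almostDecomposable hf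
    hp.weakStarMeasurable hu hp.stronglyMeasurable ht hb hB hWc hW hg hgu hL
  have hIw := (h.paired w hw).integralFunctional_ne_top_of_le (fun _ =>
    aemeasurable_conjugateIntegrand hf hp.weakStarMeasurable hp.stronglyMeasurable) ht hb hφw
  calc exhIntegral μ (conjugateIntegrand f v u) + L
      ≤ exhIntegral μ (conjugateIntegrand f v w) := hLw
    _ = pairing μ w v - integralFunctional μ f w :=
        ((h.paired w hw).pairing_sub_integralFunctional hf hIw).symm
    _ ≤ conjugateFunctional μ f R v := le_conjugateFunctional hw

lemma le_conjugateFunctional_of_isEssSup {m : Set Ω → Ω → EReal}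
    (h : Admissible μ R f v) (hm : ∀ A ∈ atomSigma μ, IsEssSupConjugateOn μ f v A (m A)) :
    exhIntegralFam μ m ≤ conjugateFunctional μ f R v := by
  have hf := h.separablyMeasurable
  obtain ⟨u, hu, hI⟩ := h.exists_ne_top
  have hp := h.paired u hu
  by_cases hI' : integralFunctional μ f u = ⊥
  · exact le_top.trans_eq (conjugateFunctional_eq_top hu hp.pairing_ne_bot hI').symm
  obtain ⟨ht, hb⟩ := hp.exhIntegral_conjugateIntegrand_finite hf hI hI'
  obtain ⟨⟨A, hA⟩, hAm, hAφ⟩ := ((isConsistent_of_isEssSupOn hm).eventually_exhIntegralFam_eq.and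
    (eventually_exhIntegral_eq (conjugateIntegrand f v u))).exists
  obtain ⟨q, hq, hφq⟩ := exists_integrable_of_extIntegral_finite
    (aemeasurable_conjugateIntegrand hf hp.weakStarMeasurable hp.stronglyMeasurable hA)
    (hAφ ▸ ht) (hAφ ▸ hb)
  obtain ⟨g, hg, hqg⟩ := hq.1.aemeasurable
  have hφg : ∀ᵐ ω ∂μ.restrict A, conjugateIntegrand f v u ω = g ω := by
    filter_upwards [hφq, hqg] with ω hω hgω
    rw [hω, hgω]
  obtain ⟨W, hW⟩ := h.exists_isEssMaximalOn hA
  obtain ⟨D, B, rfl, hDB, hD, hDμ, hB, hfin⟩ := exists_decomposition_of_mem_atomSigma hA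
  obtain ⟨hφgD, hφgB⟩ := (ae_restrict_union_iff _ _ _).1 hφg
  calc exhIntegralFam μ m
      = extIntegral (μ.restrict (D ∪ B)) fun ω => conjugateOn (f ω) W (v ω) :=
        hAm.trans (extIntegral_congr ((hm _ hA).ae_eq hW.isEssSupConjugateOn))
    _ ≤ ((∫ ω in D ∪ B, g ω ∂μ : ℝ) : EReal) +
          ∫⁻ ω in D ∪ B, (conjugateOn (f ω) W (v ω) - g ω).toENNReal ∂μ :=
        extIntegral_le_add_lintegral_sub (hq.congr hqg) hW.aemeasurable
    _ = exhIntegral μ (conjugateIntegrand f v u) +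
          ∫⁻ ω in B, (conjugateOn (f ω) W (v ω) - g ω).toENNReal ∂μ := by
        rw [hp.setLIntegral_union_sub_eq hf hI h.nonposOnInfiniteAtoms hDμ hD hB hDB
          hW.isSeparable hφgD, hAφ, extIntegral_congr hφg, extIntegral_coe (hq.congr hqg)]
    _ ≤ conjugateFunctional μ f R v :=
        h.exhIntegral_add_lintegral_le_conjugateFunctional hu hI hI' hB hW.isClosed
          hW.isSeparable hg hφgB

theorem conjugateFunctional_eq {m : Set Ω → Ω → EReal} (h : Admissible μ R f v)
    (hm : ∀ A ∈ atomSigma μ, IsEssSupConjugateOn μ f v A (m A)) :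
    conjugateFunctional μ f R v = exhIntegralFam μ m :=
  (h.conjugateFunctional_le hm).antisymm (h.le_conjugateFunctional_of_isEssSup hm)

end Admissible

end ConjugateFunctional

/-! ### Subdifferentials -/

section Subdifferential

lemma coe_add_sub_le_iff (p q r : ℝ) (t : EReal) :
    (r : EReal) + ((q : EReal) - p) ≤ t ↔ (q : EReal) - t ≤ (p : EReal) - r := by
  rw [← EReal.coe_sub, ← EReal.coe_sub, ← EReal.coe_add]
  induction t with
  | bot =>
    rw [EReal.coe_sub_bot, le_bot_iff, top_le_iff]
    exact iff_of_false (EReal.coe_ne_bot _) (EReal.coe_ne_top _)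
  | top => exact iff_of_true le_top bot_le
  | coe t =>
    rw [← EReal.coe_sub, EReal.coe_le_coe_iff, EReal.coe_le_coe_iff]
    constructor <;> intro h <;> linarith

lemma mem_subdifferentialOn_iff {X : Type*} [NormedAddCommGroup X] [NormedSpace ℝ X]
    {g : X → EReal} {W : Set X} {x : X} (hx : x ∈ W) (ht : g x ≠ ⊤) (hb : g x ≠ ⊥)
    (x' : X →L[ℝ] ℝ) :
    x' ∈ subdifferentialOn g W x ↔ conjugateOn g W x' ≤ ((x' x : ℝ) : EReal) - g x := by
  have hsub (y : X) : g x + ((x' (y - x) : ℝ) : EReal) ≤ g y ↔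
      ((x' y : ℝ) : EReal) - g y ≤ ((x' x : ℝ) : EReal) - g x := by
    lift g x to ℝ using ⟨ht, hb⟩ with r
    rw [map_sub, EReal.coe_sub]
    exact coe_add_sub_le_iff _ _ _ _
  simp only [subdifferentialOn, conjugateOn, iSup₂_le_iff, Set.mem_ofPred_eq, hsub]
  exact ⟨fun h => h.2.2.2, fun h => ⟨hx, ht, hb, h⟩⟩

variable {Ω X : Type*} [MeasurableSpace Ω] {μ : Measure Ω} [NormedAddCommGroup X]
  [NormedSpace ℝ X] [MeasurableSpace X] [BorelSpace X] {R : Submodule ℝ (Ω → X)}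
  {S : Submodule ℝ (Ω → X →L[ℝ] ℝ)} {f : Ω → X → EReal} {v : Ω → X →L[ℝ] ℝ} {u w : Ω → X}
  {A : Set Ω}

lemma IsPaired.pairing_sub (hw : IsPaired μ w v) (hu : IsPaired μ u v) :
    pairing μ (w - u) v = pairing μ w v - pairing μ u v := by
  obtain ⟨A, hA, hwA, huA⟩ := ((eventually_exhIntegral_eq fun ω =>
    ((v ω ((w - u) ω) : ℝ) : EReal)).and
      (hw.eventually_pairing_eq.and hu.eventually_pairing_eq)).exists
  have hwi := hw.integrable_apply A.2
  have hui := hu.integrable_apply A.2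
  rw [hwA, huA, pairing, hA, ← EReal.coe_sub, ← integral_sub hwi hui]
  simp only [Pi.sub_apply, map_sub]
  exact extIntegral_coe (hwi.sub hui)

lemma mem_subdifferentialFunctional_iff_conjugateFunctional (hp : ∀ w ∈ R, IsPaired μ w v)
    (hv : v ∈ S) (hu : u ∈ R) (hI : integralFunctional μ f u ≠ ⊤)
    (hI' : integralFunctional μ f u ≠ ⊥) :
    v ∈ subdifferentialFunctional μ f R S u ↔
      conjugateFunctional μ f R v ≤ pairing μ u v - integralFunctional μ f u := by
  have hsub (w : Ω → X) (hw : w ∈ R) :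
      integralFunctional μ f u + pairing μ (w - u) v ≤ integralFunctional μ f w ↔
        pairing μ w v - integralFunctional μ f w ≤
          pairing μ u v - integralFunctional μ f u := by
    rw [(hp w hw).pairing_sub (hp u hu), ← EReal.coe_toReal hI hI',
      ← EReal.coe_toReal (hp u hu).pairing_ne_top (hp u hu).pairing_ne_bot,
      ← EReal.coe_toReal (hp w hw).pairing_ne_top (hp w hw).pairing_ne_bot]
    exact coe_add_sub_le_iff _ _ _ _
  simp only [subdifferentialFunctional, conjugateFunctional, iSup₂_le_iff, Set.mem_ofPred_eq]
  exact ⟨fun h w hw => (hsub w hw).1 (h.2.2.2 w hw),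
    fun h => ⟨hv, hI, hI', fun w hw => (hsub w hw).2 (h w hw)⟩⟩

lemma ae_integrand_finite (hf : IntegrallySeparablyMeasurable μ f)
    (hu : IntegrallyStronglyMeasurable μ u) (hI : integralFunctional μ f u ≠ ⊤)
    (hI' : integralFunctional μ f u ≠ ⊥) (hA : A ∈ atomSigma μ) :
    ∀ᵐ ω ∂μ.restrict A, f ω (u ω) ≠ ⊤ ∧ f ω (u ω) ≠ ⊥ := by
  obtain ⟨q, -, hfq⟩ := exists_integrable_of_extIntegral_finite (aemeasurable_integrand hf hu hA)
    (extIntegral_restrict_ne_top hI hA) (extIntegral_restrict_ne_bot hI hI' hA)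
  filter_upwards [hfq] with ω hω
  exact hω ▸ ⟨EReal.coe_ne_top _, EReal.coe_ne_bot _⟩

namespace Admissible

variable [CompleteSpace X]

lemma mem_subdifferentialFunctional_iff_conjugateOn (h : Admissible μ R f v) (hv : v ∈ S)
    (hu : u ∈ R) (hI : integralFunctional μ f u ≠ ⊤) (hI' : integralFunctional μ f u ≠ ⊥) :
    v ∈ subdifferentialFunctional μ f R S u ↔
      ∀ A ∈ atomSigma μ, ∀ W : Set X, IsSeparable W →
        ∀ᵐ ω ∂μ.restrict A, conjugateOn (f ω) W (v ω) ≤ conjugateIntegrand f v u ω := by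
  have hf := h.separablyMeasurable
  have hp := h.paired u hu
  choose! W hW using fun A => h.exists_isEssMaximalOn (A := A)
  have hm := fun A hA => (hW A hA).isEssSupConjugateOn
  rw [mem_subdifferentialFunctional_iff_conjugateFunctional h.paired hv hu hI hI',
    hp.pairing_sub_integralFunctional hf hI, h.conjugateFunctional_eq hm]
  refine ⟨fun hle A hA W' hW' => ?_, fun hle => exhIntegralFam_mono fun A hA =>
    hle A hA (W A) (hW A hA).isSeparable⟩
  have hφ := fun A hA => ae_conjugateIntegrand_le hp.stronglyMeasurable hA (hm A hA)
  obtain ⟨ht, hb⟩ := hp.exhIntegral_conjugateIntegrand_finite hf hI hI'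
  filter_upwards [(hW A hA).ae_le W' hW', ae_eq_of_exhIntegralFam_eq (isConsistent_const _)
    (isConsistent_of_isEssSupOn hm) (fun A hA => aemeasurable_conjugateIntegrand hf
      hp.weakStarMeasurable hp.stronglyMeasurable hA) (fun A hA => (hW A hA).aemeasurable) hφ
      ((exhIntegralFam_mono hφ).antisymm hle) ht hb hA] with ω hle hω
  exact hle.trans_eq hω.symm

theorem mem_subdifferentialFunctional_iff (h : Admissible μ R f v) (hv : v ∈ S) (hu : u ∈ R)
    (hI : integralFunctional μ f u ≠ ⊤) (hI' : integralFunctional μ f u ≠ ⊥) :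
    v ∈ subdifferentialFunctional μ f R S u ↔
      ∀ A ∈ atomSigma μ, ∀ W : Set X, IsSeparable W → (∀ᵐ ω ∂μ.restrict A, u ω ∈ W) →
        ∀ᵐ ω ∂μ.restrict A, v ω ∈ subdifferentialOn (f ω) W (u ω) := by
  have hum := (h.paired u hu).stronglyMeasurable
  have hfin := fun A hA =>
    ae_integrand_finite (A := A) h.separablyMeasurable hum hI hI' hA
  rw [h.mem_subdifferentialFunctional_iff_conjugateOn hv hu hI hI']
  refine ⟨fun hle A hA W hW huW => ?_, fun hsub A hA W hW => ?_⟩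
  · filter_upwards [hle A hA W hW, huW, hfin A hA] with ω hω hωW hωfin
    exact (mem_subdifferentialOn_iff hωW hωfin.1 hωfin.2 _).2 hω
  · have huW : ∀ᵐ ω ∂μ.restrict A, u ω ∈ W ∪ u '' A := by
      filter_upwards [ae_restrict_mem (measurableSet_of_mem_atomSigma hA)] with ω hω
      exact Or.inr (Set.mem_image_of_mem u hω)
    filter_upwards [hsub A hA _ (hW.union (hum.isSeparable_image hA)) huW, huW, hfin A hA]
      with ω hω hωW hωfin
    exact (conjugateOn_mono _ Set.subset_union_left _).trans
      ((mem_subdifferentialOn_iff hωW hωfin.1 hωfin.2 _).1 hω)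

theorem mem_subdifferentialFunctional_iff_mem_iInter (h : Admissible μ R f v) (hv : v ∈ S)
    (hu : u ∈ R) (hI : integralFunctional μ f u ≠ ⊤) (hI' : integralFunctional μ f u ≠ ⊥)
    (hne : (separableRange μ u).Nonempty) :
    v ∈ subdifferentialFunctional μ f R S u ↔
      v ∈ ⋂ W ∈ separableRange μ u,
        {v' | v' ∈ S ∧ IAE μ (fun ω => v' ω ∈ subdifferentialOn (f ω) W (u ω))} := by
  rw [h.mem_subdifferentialFunctional_iff hv hu hI hI']
  simp only [Set.mem_iInter, Set.mem_ofPred_eq]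
  refine ⟨fun hsub W hW => ⟨hv, fun A hA => hsub A hA W hW.1 (hW.2 A hA)⟩,
    fun hsub A hA W hW huW => ?_⟩
  obtain ⟨W₀, hW₀, huW₀⟩ := hne
  have hU : W ∪ W₀ ∈ separableRange μ u :=
    ⟨hW.union hW₀, fun A hA => (huW₀ A hA).mono fun ω hω => Or.inr hω⟩
  filter_upwards [(hsub _ hU).2 A hA, huW] with ω ⟨_, ht, hb, hle⟩ hωW
  exact ⟨hωW, ht, hb, fun y hy => hle y (Or.inl hy)⟩

theorem mem_subdifferentialFunctional_iff_iae (h : Admissible μ R f v) (hv : v ∈ S)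
    (hsep : ∀ A ∈ atomSigma μ, ∃ W : Set X, IsSeparable W ∧
      ∀ᵐ ω ∂μ.restrict A, conjugate (f ω) (v ω) = conjugateOn (f ω) W (v ω))
    (hu : u ∈ R) (hI : integralFunctional μ f u ≠ ⊤) (hI' : integralFunctional μ f u ≠ ⊥) :
    v ∈ subdifferentialFunctional μ f R S u ↔
      v ∈ {v' | v' ∈ S ∧ IAE μ (fun ω => v' ω ∈ subdifferentialOn (f ω) Set.univ (u ω))} := by
  have hfin := fun A hA => ae_integrand_finite (A := A) h.separablyMeasurable
    (h.paired u hu).stronglyMeasurable hI hI' hA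
  rw [h.mem_subdifferentialFunctional_iff_conjugateOn hv hu hI hI']
  refine ⟨fun hle => ⟨hv, fun A hA => ?_⟩, fun ⟨_, hsub⟩ A hA W _ => ?_⟩
  · obtain ⟨W, hW, hWeq⟩ := hsep A hA
    filter_upwards [hle A hA W hW, hWeq, hfin A hA] with ω hω hωeq hωfin
    rw [mem_subdifferentialOn_iff (Set.mem_univ _) hωfin.1 hωfin.2, conjugateOn_univ, hωeq]
    exact hω
  · filter_upwards [hsub A hA, hfin A hA] with ω hω hωfin
    exact (conjugateOn_mono _ (Set.subset_univ W) _).trans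
      ((mem_subdifferentialOn_iff (Set.mem_univ _) hωfin.1 hωfin.2 _).1 hω)

end Admissible

end Subdifferential

/-! ### The conjugate under the integral sign -/

namespace Admissible

variable {Ω X : Type*} [MeasurableSpace Ω] {μ : Measure Ω} [NormedAddCommGroup X]
  [NormedSpace ℝ X] [MeasurableSpace X] {R : Submodule ℝ (Ω → X)}
  {f : Ω → X → EReal} {v : Ω → X →L[ℝ] ℝ}

lemma exists_integralFunctional_finite (h : Admissible μ R f v)
    (ht : conjugateFunctional μ f R v < ⊤) :
    ∃ u ∈ R, integralFunctional μ f u ≠ ⊤ ∧ integralFunctional μ f u ≠ ⊥ := by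
  obtain ⟨u, hu, hI⟩ := h.exists_ne_top
  exact ⟨u, hu, hI, fun hI' =>
    ht.ne (conjugateFunctional_eq_top hu (h.paired u hu).pairing_ne_bot hI')⟩

lemma conjugateFunctional_ne_bot (h : Admissible μ R f v) : conjugateFunctional μ f R v ≠ ⊥ := by
  obtain ⟨u, hu, hI⟩ := h.exists_ne_top
  have hp := h.paired u hu
  refine ne_bot_of_le_ne_bot ?_ (le_conjugateFunctional hu)
  rw [← EReal.coe_toReal hp.pairing_ne_top hp.pairing_ne_bot, sub_eq_add_neg]
  exact EReal.add_ne_bot_iff.2 ⟨EReal.coe_ne_bot _, EReal.neg_eq_bot_iff.not.2 hI⟩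

variable [BorelSpace X] [CompleteSpace X]

theorem conjugate_integral_iff (h : Admissible μ R f v) (ht : conjugateFunctional μ f R v < ⊤) :
    ((∀ A ∈ atomSigma μ, AEMeasurable (fun ω => conjugate (f ω) (v ω)) (μ.restrict A)) ∧
        conjugateFunctional μ f R v = exhIntegral μ (fun ω => conjugate (f ω) (v ω))) ↔
      ∀ A ∈ atomSigma μ, ∃ W : Set X, IsSeparable W ∧
        ∀ᵐ ω ∂μ.restrict A, conjugate (f ω) (v ω) = conjugateOn (f ω) W (v ω) := by
  choose! W hW using fun A => h.exists_isEssMaximalOn (A := A)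
  have hm := fun A hA => (hW A hA).isEssSupConjugateOn
  have heq := h.conjugateFunctional_eq hm
  refine ⟨fun ⟨hmeas, hint⟩ A hA => ⟨W A, (hW A hA).isSeparable, ?_⟩, fun hsep => ?_⟩
  · exact Filter.EventuallyEq.symm <| ae_eq_of_exhIntegralFam_eq (isConsistent_of_isEssSupOn hm)
      (isConsistent_const _) (fun A hA => (hW A hA).aemeasurable) hmeas
      (fun A _ => ae_of_all _ fun ω => conjugateOn_le_conjugate _ _) (heq.symm.trans hint)
      (heq ▸ ht.ne) (heq ▸ h.conjugateFunctional_ne_bot) hA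
  · have hae (A : Set Ω) (hA : A ∈ atomSigma μ) :
        (fun ω => conjugateOn (f ω) (W A) (v ω)) =ᵐ[μ.restrict A]
          fun ω => conjugate (f ω) (v ω) := by
      obtain ⟨W', hW', hWeq⟩ := hsep A hA
      filter_upwards [hWeq, (hW A hA).ae_le W' hW'] with ω hω hle
      exact (conjugateOn_le_conjugate _ _).antisymm (hω.trans_le hle)
    exact ⟨fun A hA => (hW A hA).aemeasurable.congr (hae A hA),
      heq.trans (exhIntegralFam_congr hae)⟩

/-- Outside a suitable `A ∈ atomSigma μ` both `f*(v)` and `⟨v, u⟩ - f(u)` vanish i.a.e., so that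
there the supremum is attained in any separable set almost containing the range of `u`. -/
theorem exists_isSeparable_iae_of_conjugate_integral (h : Admissible μ R f v)
    (ht : conjugateFunctional μ f R v < ⊤) (hne : ∀ u ∈ R, (separableRange μ u).Nonempty)
    (hmeas : ∀ A ∈ atomSigma μ, AEMeasurable (fun ω => conjugate (f ω) (v ω)) (μ.restrict A))
    (hint : conjugateFunctional μ f R v = exhIntegral μ (fun ω => conjugate (f ω) (v ω))) :
    ∃ W : Set X, IsSeparable W ∧
      IAE μ (fun ω => conjugate (f ω) (v ω) = conjugateOn (f ω) W (v ω)) := by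
  have hf := h.separablyMeasurable
  obtain ⟨u, hu, hI, hI'⟩ := h.exists_integralFunctional_finite ht
  have hp := h.paired u hu
  obtain ⟨htu, hbu⟩ := hp.exhIntegral_conjugateIntegrand_finite hf hI hI'
  have hconjzero := (isConsistent_const _).eventually_eq_zero hmeas
    (hint.symm.trans_ne ht.ne) (hint.symm.trans_ne h.conjugateFunctional_ne_bot)
  have hφzero := (isConsistent_const _).eventually_eq_zero
    (fun A hA => aemeasurable_conjugateIntegrand hf hp.weakStarMeasurable
      hp.stronglyMeasurable hA) htu hbu
  obtain ⟨A₀, hconj, hφ⟩ := (hconjzero.and hφzero).exists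
  obtain ⟨W₀, hW₀, huW₀⟩ := hne u hu
  obtain ⟨W₁, hW₁, hW₁eq⟩ := (h.conjugate_integral_iff ht).1 ⟨hmeas, hint⟩ A₀ A₀.2
  rw [ae_restrict_iff' (measurableSet_of_mem_atomSigma A₀.2)] at hW₁eq
  refine ⟨W₁ ∪ W₀, hW₁.union hW₀, fun A hA => ?_⟩
  have hU : (A₀ ∪ A : Set Ω) ∈ atomSigma μ := union_mem_atomSigma A₀.2 hA
  refine ae_restrict_of_ae_restrict_of_subset (Set.subset_union_right (s := A₀.1)) ?_
  filter_upwards [hconj ⟨_, hU⟩ Set.subset_union_left, hφ ⟨_, hU⟩ Set.subset_union_left,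
    ae_restrict_of_ae hW₁eq, huW₀ _ hU] with ω hωconj hωφ hωW₁ hωW₀
  refine le_antisymm ?_ (conjugateOn_le_conjugate _ _)
  by_cases hω : ω ∈ A₀.1
  · exact (hωW₁ hω).trans_le (conjugateOn_mono _ Set.subset_union_left _)
  · rw [hωconj hω, ← hωφ hω]
    exact le_conjugateOn _ (Set.mem_union_right W₁ hωW₀) _

end Admissible

end IntegralConjugate

end

open IntegralConjugate in
theorem theorem2p4 {Ω X : Type*} [MeasurableSpace Ω] (μ : Measure Ω)
    [NormedAddCommGroup X] [NormedSpace ℝ X] [CompleteSpace X]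
    [MeasurableSpace X] [BorelSpace X]
    (R : Submodule ℝ (Ω → X)) (S : Submodule ℝ (Ω → X →L[ℝ] ℝ))
    (hR : ∀ u ∈ R, IntegrallyStronglyMeasurable μ u)
    (hRdec : AlmostDecomposable μ (R : Set (Ω → X)))
    (hS : ∀ v ∈ S, IntegrallyWeakStarMeasurable μ v)
    (hpair : ∀ u ∈ R, ∀ v ∈ S, pairing μ u v ≠ ⊤ ∧ pairing μ u v ≠ ⊥)
    (f : Ω → X → EReal) (hf : IntegrallySeparablyMeasurable μ f)
    (hI : ∃ u ∈ R, integralFunctional μ f u ≠ ⊤)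
    (v : Ω → X →L[ℝ] ℝ) (hv : v ∈ S)
    (hatom : ∀ A : Set Ω, IsMeasureAtom μ A → μ A = ∞ → ∀ W : Set X, IsSeparable W →
      ∀ᵐ ω ∂(μ.restrict A), conjugateOn (f ω) W (v ω) ≤ 0) :
    -- the essential supremum exists on each set of `atomSigma μ`, and its integral is `I_f*(v)`
    ((∀ A ∈ atomSigma μ, ∃ m : Ω → EReal,
        IsEssSupOn μ A (fun (W : {W : Set X // IsSeparable W}) ω =>
          conjugateOn (f ω) (W : Set X) (v ω)) m) ∧
      ∀ m : Set Ω → Ω → EReal,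
        (∀ A ∈ atomSigma μ, IsEssSupOn μ A (fun (W : {W : Set X // IsSeparable W}) ω =>
          conjugateOn (f ω) (W : Set X) (v ω)) (m A)) →
        conjugateFunctional μ f R v = exhIntegralFam μ m) ∧
    -- the subdifferential
    (∀ u ∈ R, integralFunctional μ f u ≠ ⊤ → integralFunctional μ f u ≠ ⊥ →
      (v ∈ subdifferentialFunctional μ f R S u ↔
        ∀ A ∈ atomSigma μ, ∀ W : Set X, IsSeparable W → (∀ᵐ ω ∂(μ.restrict A), u ω ∈ W) →
          ∀ᵐ ω ∂(μ.restrict A), v ω ∈ subdifferentialOn (f ω) W (u ω)) ∧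
      ((separableRange μ u).Nonempty →
        (v ∈ subdifferentialFunctional μ f R S u ↔
          v ∈ ⋂ W ∈ separableRange μ u,
            {v' | v' ∈ S ∧ IAE μ (fun ω => v' ω ∈ subdifferentialOn (f ω) W (u ω))}))) ∧
    -- the conjugate under the integral sign
    (conjugateFunctional μ f R v < ⊤ →
      (((∀ A ∈ atomSigma μ, AEMeasurable (fun ω => conjugate (f ω) (v ω)) (μ.restrict A)) ∧
          conjugateFunctional μ f R v = exhIntegral μ (fun ω => conjugate (f ω) (v ω))) ↔
        ∀ A ∈ atomSigma μ, ∃ W : Set X, IsSeparable W ∧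
          ∀ᵐ ω ∂(μ.restrict A), conjugate (f ω) (v ω) = conjugateOn (f ω) W (v ω)) ∧
      ((∀ u ∈ R, (separableRange μ u).Nonempty) →
        (((∀ A ∈ atomSigma μ, AEMeasurable (fun ω => conjugate (f ω) (v ω)) (μ.restrict A)) ∧
            conjugateFunctional μ f R v = exhIntegral μ (fun ω => conjugate (f ω) (v ω))) ↔
          ∃ W : Set X, IsSeparable W ∧
            IAE μ (fun ω => conjugate (f ω) (v ω) = conjugateOn (f ω) W (v ω)))) ∧
      ((∀ A ∈ atomSigma μ, ∃ W : Set X, IsSeparable W ∧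
          ∀ᵐ ω ∂(μ.restrict A), conjugate (f ω) (v ω) = conjugateOn (f ω) W (v ω)) →
        ∀ u ∈ R, integralFunctional μ f u ≠ ⊤ → integralFunctional μ f u ≠ ⊥ →
          (v ∈ subdifferentialFunctional μ f R S u ↔
            v ∈ {v' | v' ∈ S ∧
              IAE μ (fun ω => v' ω ∈ subdifferentialOn (f ω) Set.univ (u ω))}))) := by
  have h : Admissible μ R f v := ⟨hRdec,
    fun u hu => ⟨hR u hu, hS v hv, (hpair u hu v hv).1, (hpair u hu v hv).2⟩, hf, hI, hatom⟩
  refine ⟨⟨fun A hA => ?_, fun m hm => h.conjugateFunctional_eq hm⟩, fun u hu hIu hIu' => ?_,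
    fun ht => ⟨h.conjugate_integral_iff ht, fun hne => ⟨fun hi => ?_, fun ⟨W, hW, hWe⟩ => ?_⟩,
      fun hsep u hu hIu hIu' => ?_⟩⟩
  · obtain ⟨W, hW⟩ := h.exists_isEssMaximalOn hA
    exact ⟨_, hW.isEssSupConjugateOn⟩
  · exact ⟨h.mem_subdifferentialFunctional_iff hv hu hIu hIu',
      h.mem_subdifferentialFunctional_iff_mem_iInter hv hu hIu hIu'⟩
  · exact h.exists_isSeparable_iae_of_conjugate_integral ht hne hi.1 hi.2
  · exact (h.conjugate_integral_iff ht).2 fun A hA => ⟨W, hW, hWe A hA⟩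
  · exact h.mem_subdifferentialFunctional_iff_iae hv hsep hu hIu hIu'
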